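/- Let $G$ be a group with identity $e$, generated by a finite non-empty symmetric set $S$ (that is, $g\in S$ implies $g^{-1}\in S$). Let $p=(p_g)_{g\in G}$ be a probability measure on $G$ whose support is finite and generates $G$, and consider the random walk on $G$ with transition probabilities $\mathcal P(g,h)=p_{g^{-1}h}$. A colored random walk on $G\times[r]$, where $[r]=\{1,\dots,r\}$, is a Markov chain with transition probabilities $\tilde{\mathcal P}((g,u),(h,v))=\tilde p_{g^{-1}h}(u,v)$, where $(\tilde p_g)_{g\in G}$ are $r\times r$ matrices with non-negative entries such that $P=\sum_{g\in G}\tilde p_g$ is a stochastic matrix. Its support is $\{g\in G:\tilde p_g\neq 0\}$. It is nearest-neighbor if its support is included in $S$, and quasi-irreducible if its support generates $G$ and the matrix $P$ is irreducible. It is reversible if there is an invariant probability measure $\pi$ of $P$ such that $\pi(u)\,\tilde{\mathcal P}((g,u),(h,v))=\pi(v)\,\tilde{\mathcal P}((h,v),(g,u))$ for all $g,h\in G$ and $u,v\in[r]$. The random walk $\mathcal P$ is reversible if $\mathcal P(g,h)=\mathcal P(h,g)$ for all $g,h\in G$. A colored random walk linearizes $\mathcal P$ if for every realization $(Y_n)_{n\ge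 0}$ of it with $Y_0=(e,1)$ there are almost surely finite stopping times $0=\tau_0<\tau_1<\tau_2<\cdots$ (for the natural filtration of $Y$) such that (i) almost surely $Y_{\tau_n}$ has color $1$ for all $n$, and the $G$-coordinate of $(Y_{\tau_n})_{n\ge0}$ is a realization of the random walk with kernel $\mathcal P$ started at $e$; (ii) the increments $\tau_{n+1}-\tau_n$, $n\ge 0$, are independent and identically distributed with finite mean. Then there exist $r\ge1$ and a nearest-neighbor, quasi-irreducible colored random walk on $G\times[r]$ which linearizes $\mathcal P$. Moreover, if $\mathcal P$ is reversible, then there exist $r\ge 1$ and a nearest-neighbor, quasi-irreducible colored random walk on $G\times[r]$ which linearizes $\mathcal P$ and is reversible. -/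

import Mathlib

open MeasureTheory ProbabilityTheory

universe u

/-! ### Markov chains on a countable state space -/

/-- Under `μ`, the process `Y` is a Markov chain with transition probabilities `Q`, started at `x₀`.
The field `step` says that `ℙ[Y (n+1) = y | Y 0, …, Y n] = Q (Y n) y`, multiplied out over the
finite-dimensional events. -/
structure IsMarkovChain {Ω E : Type*} [MeasurableSpace Ω] [MeasurableSpace E]
    (Q : E → E → ℝ) (x₀ : E) (Y : ℕ → Ω → E) (μ : Measure Ω) : Prop where
  isProbabilityMeasure : IsProbabilityMeasure μ
  measurable : ∀ n, Measurable (Y n)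
  init : ∀ᵐ ω ∂μ, Y 0 ω = x₀
  step : ∀ (n : ℕ) (x : ℕ → E),
    μ.real {ω | ∀ i ≤ n + 1, Y i ω = x i} =
      μ.real {ω | ∀ i ≤ n, Y i ω = x i} * Q (x n) (x (n + 1))

/-- The kernel `Q` is reversible with respect to the measure `ν`. -/
def IsReversibleWrt {E : Type*} (Q : E → E → ℝ) (ν : E → ℝ) : Prop :=
  ∀ x y, ν x * Q x y = ν y * Q y x

/-- The natural filtration of a process. -/
def processFiltration {Ω E : Type*} [mΩ : MeasurableSpace Ω] [mE : MeasurableSpace E]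
    (Y : ℕ → Ω → E) (hY : ∀ n, Measurable (Y n)) : Filtration ℕ mΩ where
  seq n := ⨆ i ≤ n, MeasurableSpace.comap (Y i) mE
  mono' _ _ h := biSup_mono fun _ hi => le_trans hi h
  le' _ := iSup₂_le fun i _ => (hY i).comap_le

/-! ### Random times -/

/-- The `n`-th increment `τ (n+1) - τ n` of a sequence of (almost surely finite) times. -/
noncomputable def timeIncrement {Ω : Type*} (τ : ℕ → Ω → WithTop ℕ) (n : ℕ) (ω : Ω) : ℝ :=
  (((τ (n + 1) ω).untopD 0 : ℕ) : ℝ) - (((τ n ω).untopD 0 : ℕ) : ℝ)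

/-- The times `τ 0 = 0 < τ 1 < τ 2 < …` are almost surely finite and form a renewal process:
their increments are independent, identically distributed and of finite mean. -/
structure IsRenewalProcess {Ω : Type*} [MeasurableSpace Ω] (τ : ℕ → Ω → WithTop ℕ)
    (μ : Measure Ω) : Prop where
  zero : ∀ ω, τ 0 ω = 0
  finite : ∀ᵐ ω ∂μ, ∀ n, τ n ω ≠ ⊤
  strictMono : ∀ᵐ ω ∂μ, StrictMono fun n => τ n ω
  indep : iIndepFun (timeIncrement τ) μ
  identDistrib : ∀ n, IdentDistrib (timeIncrement τ n) (timeIncrement τ 0) μ μ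
  finite_mean : Integrable (timeIncrement τ 0) μ

/-- The value at the random time `σ` of the process `Y` (the value at `⊤` is irrelevant). -/
def valueAt {Ω E : Type*} (Y : ℕ → Ω → E) (σ : Ω → WithTop ℕ) (ω : Ω) : E :=
  Y ((σ ω).untopD 0) ω

/-! ### Random walks and colored random walks on a group -/

/-- The transition probabilities `p (g⁻¹ h)` of the random walk on `G` with step distribution
`p`. -/
def walkKernel {G : Type*} [Group G] (p : G → ℝ) (g h : G) : ℝ := p (g⁻¹ * h)

/-- The data of a colored random walk on `G × [r]`: matrices `p g` with non-negative entries whose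
sum over `g ∈ G` is a stochastic matrix. The set of colors `[r]` is `Fin r`; the color `1` is its
first element `0`. -/
structure ColoredWalk (G : Type*) (r : ℕ) where
  p : G → Matrix (Fin r) (Fin r) ℝ
  nonneg : ∀ g u v, 0 ≤ p g u v
  summable : Summable p
  stochastic : ∑' g, p g ∈ Matrix.rowStochastic ℝ (Fin r)

namespace ColoredWalk

variable {G : Type*} {r : ℕ}

/-- The transition matrix `P = ∑ g, p g` of the chain of colors. -/
noncomputable def colorMatrix (W : ColoredWalk G r) : Matrix (Fin r) (Fin r) ℝ := ∑' g, W.p g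

/-- The transition probabilities of the colored walk. -/
def kernel [Group G] (W : ColoredWalk G r) (x y : G × Fin r) : ℝ :=
  W.p (x.1⁻¹ * y.1) x.2 y.2

/-- The set of `g` with `p g ≠ 0`. -/
def support (W : ColoredWalk G r) : Set G := {g | W.p g ≠ 0}

/-- The support is included in the set of generators `S`. -/
def IsNearestNeighbor (W : ColoredWalk G r) (S : Set G) : Prop := W.support ⊆ S

/-- The support generates the group and the matrix of the colors is irreducible. -/
def IsQuasiIrreducible [Group G] (W : ColoredWalk G r) : Prop :=
  Subgroup.closure W.support = ⊤ ∧ W.colorMatrix.IsIrreducible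

/-- Reversibility with respect to the product of the counting measure on `G` and of an invariant
probability measure `π` of `P` on the colors. -/
def IsReversible [Group G] (W : ColoredWalk G r) : Prop :=
  ∃ π ∈ stdSimplex ℝ (Fin r), Matrix.vecMul π W.colorMatrix = π ∧
    IsReversibleWrt W.kernel fun x => π x.2

end ColoredWalk

/-- Every stochastic kernel on a countable set is the kernel of a Markov chain, so that `IsMarkovChain`
is not void. -/
theorem exists_isMarkovChain {E : Type u} [MeasurableSpace E] [Countable E]
    [DiscreteMeasurableSpace E] (Q : E → E → ℝ) (hQ : ∀ x y, 0 ≤ Q x y)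
    (hQ' : ∀ x, HasSum (Q x) 1) (x₀ : E) :
    ∃ μ : Measure (ℕ → E), IsMarkovChain Q x₀ (fun n ω => ω n) μ := by
  let q : E → PMF E := fun x => ⟨fun y => ENNReal.ofReal (Q x y), by
    have h := ENNReal.ofReal_tsum_of_nonneg (hQ x) (hQ' x).summable
    rw [(hQ' x).tsum_eq, ENNReal.ofReal_one] at h
    rw [h]; exact ENNReal.summable.hasSum⟩
  have hm : ∀ n : ℕ, Measurable fun x : (Π _ : Finset.Iic n, E) =>
      (q (x ⟨n, by simp⟩)).toMeasure := fun n =>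
    (Measurable.of_discrete (f := fun x : E => (q x).toMeasure)).comp
      (measurable_pi_apply (⟨n, by simp⟩ : Finset.Iic n))
  let κ : (n : ℕ) → Kernel (Π _ : Finset.Iic n, E) E := fun n => ⟨_, hm n⟩
  have hκ : ∀ n, IsMarkovKernel (κ n) := fun n => ⟨fun x => by
    change IsProbabilityMeasure (q (x ⟨n, by simp⟩)).toMeasure; infer_instance⟩
  refine ⟨Kernel.traj (X := fun _ => E) κ 0 (fun _ => x₀), inferInstance,
    fun n => measurable_pi_apply n, ?_, fun n x => ?_⟩
  · have h0 := Kernel.traj_map_frestrictLe_apply (X := fun _ => E) (κ := κ) 0 0 (fun _ => x₀)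
    rw [Kernel.partialTraj_self, Kernel.id_apply] at h0
    have h1 : ∀ᵐ y ∂(Measure.dirac (fun _ : Finset.Iic 0 => x₀)), y ⟨0, by simp⟩ = x₀ := by
      rw [ae_dirac_iff (measurableSet_eq_fun (measurable_pi_apply _) measurable_const)]
    rw [← h0] at h1
    exact ae_of_ae_map (by fun_prop) h1
  · set μ := Kernel.traj (X := fun _ => E) κ 0 (fun _ => x₀) with hμ
    have h := Kernel.partialTraj_compProd_eq_map_traj (X := fun _ => E) (κ := κ) (Nat.zero_le n)
      (x₀ := fun _ => x₀)
    rw [← Kernel.traj_map_frestrictLe_apply, ← hμ] at h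
    let A : Set (Π _ : Finset.Iic n, E) := {fun i : Finset.Iic n => x i}
    have hA : MeasurableSet A := measurableSet_singleton _
    have h2 := congrArg (fun m => m (A ×ˢ {x (n + 1)})) h
    beta_reduce at h2
    rw [Measure.compProd_apply_prod hA (measurableSet_singleton _),
      Measure.map_apply (by fun_prop) (hA.prod (measurableSet_singleton _))] at h2
    have e1 : (fun ω : ℕ → E => (Preorder.frestrictLe (π := fun _ => E) n ω, ω (n + 1))) ⁻¹'
        (A ×ˢ {x (n + 1)}) = {ω | ∀ i ≤ n + 1, ω i = x i} := by
      ext ω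
      simp only [A, Set.mem_preimage, Set.mem_prod, Set.mem_singleton_iff, funext_iff,
        Set.mem_ofPred_eq, Preorder.frestrictLe_apply, Subtype.forall, Finset.mem_Iic]
      constructor
      · rintro ⟨h1, h2⟩ i hi
        rcases Nat.le_succ_iff.1 hi with hi | rfl
        exacts [h1 i hi, h2]
      · exact fun h => ⟨fun i hi => h i (by omega), h _ le_rfl⟩
    have e2 : Preorder.frestrictLe (π := fun _ => E) n ⁻¹' A = {ω | ∀ i ≤ n, ω i = x i} := by
      ext ω
      simp [A, funext_iff]
    have e3 : ∫⁻ a in A, κ n a {x (n + 1)} ∂(μ.map (Preorder.frestrictLe n)) =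
        ENNReal.ofReal (Q (x n) (x (n + 1))) * μ {ω | ∀ i ≤ n, ω i = x i} := by
      have : ∀ a ∈ A, κ n a {x (n + 1)} = ENNReal.ofReal (Q (x n) (x (n + 1))) := by
        rintro a rfl
        change (q (x n)).toMeasure {x (n + 1)} = _
        rw [PMF.toMeasure_apply_singleton _ _ (measurableSet_singleton _)]
        rfl
      rw [setLIntegral_congr_fun hA this, setLIntegral_const,
        Measure.map_apply (by fun_prop) hA, e2]
    rw [e1, e3] at h2
    rw [measureReal_def, ← h2, ENNReal.toReal_mul, ENNReal.toReal_ofReal (hQ _ _), mul_comm]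
    rfl

/-- The transition probabilities of a colored walk sum to one. -/
theorem ColoredWalk.hasSum_kernel {G : Type*} [Group G] {r : ℕ} (W : ColoredWalk G r)
    (x : G × Fin r) : HasSum (W.kernel x) 1 := by
  have h1 : ∀ v, HasSum (fun g => W.p g x.2 v) ((∑' g, W.p g) x.2 v) := fun v =>
    Pi.hasSum.1 (Pi.hasSum.1 W.summable.hasSum x.2) v
  have h2 : ∑ v, (∑' g, W.p g) x.2 v = 1 := by
    simpa [Matrix.mulVec, dotProduct] using congrFun W.stochastic.2 x.2
  have h3 : ∀ v, HasSum (fun h => W.kernel x (h, v)) ((∑' g, W.p g) x.2 v) := fun v =>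
    (Equiv.mulLeft x.1⁻¹).hasSum_iff.2 (h1 v)
  have h4 : Summable (W.kernel x) := by
    rw [← (Equiv.prodComm (Fin r) G).summable_iff]
    refine (summable_prod_of_nonneg fun y => W.nonneg _ _ _).2 ⟨fun v => (h3 v).summable, ?_⟩
    exact Summable.of_finite
  have h5 := ((Equiv.prodComm (Fin r) G).hasSum_iff.2 h4.hasSum).prod_fiberwise h3
  have h6 : ∑' y, W.kernel x y = 1 := h5.unique (h2 ▸ hasSum_fintype _)
  exact h6 ▸ h4.hasSum

/-- The colored walk has a realization from every starting point. -/
theorem ColoredWalk.exists_realization {G : Type u} [Group G] [Countable G] [MeasurableSpace G]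
    [DiscreteMeasurableSpace G] {r : ℕ} (W : ColoredWalk G r) (x₀ : G × Fin r) :
    ∃ μ : Measure (ℕ → G × Fin r), IsMarkovChain W.kernel x₀ (fun n ω => ω n) μ :=
  exists_isMarkovChain _ (fun _ _ => W.nonneg _ _ _) W.hasSum_kernel x₀

/-- The colored walk `W` linearizes the random walk with step distribution `p`: every realization
`Y` of `W` started at `(e, 1)` has stopping times `τ n`, forming a renewal process, at which the
color is `1` and along which the `G`-coordinate is a realization of the random walk started
at `e`. -/
def ColoredWalk.Linearizes {G : Type u} [Group G] [MeasurableSpace G] {r : ℕ} [NeZero r]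
    (W : ColoredWalk G r) (p : G → ℝ) : Prop :=
  ∀ (Ω : Type u) [MeasurableSpace Ω] (μ : Measure Ω) (Y : ℕ → Ω → G × Fin r)
    (hY : IsMarkovChain W.kernel (1, 0) Y μ),
    ∃ τ : ℕ → Ω → WithTop ℕ,
      (∀ n, IsStoppingTime (processFiltration Y hY.measurable) (τ n)) ∧
      IsRenewalProcess τ μ ∧
      (∀ᵐ ω ∂μ, ∀ n, (valueAt Y (τ n) ω).2 = 0) ∧
      IsMarkovChain (walkKernel p) 1 (fun n ω => (valueAt Y (τ n) ω).1) μ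

/-! For each `x` in the support of `p`, choose a word in `S` of length `ℓ ≥ 3` that spells `x`. The
colors form a bouquet of loops glued at the color `0`, with one loop of length `ℓ` per `x`. A loop
gives two arms, one for each direction, and traversing an arm multiplies the `G`-coordinate by `x`
or by `x⁻¹`. Inside a loop the colors make a simple symmetric walk. Each step carries the letter of
the edge crossed, inverted when the edge is crossed backwards. The displacement is therefore a
function of the position on the arm, and falling back to the start of the arm cancels it.

By gambler's ruin, a walk that has just entered an arm of length `ℓ` reaches its far end before
falling back with probability `1 / ℓ`. If the arm `b` is entered with probability proportional to `e
b * ℓ b`, an attempt completes `b` with probability proportional to `e b`. Failed attempts leave no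
displacement, so the first completed arm has law `e`. Putting all of `p` on the forward arms gives a
step of law `p`. When `p` is symmetric, putting half of it on each direction gives the same law and
makes the colored walk reversible.

The times `τ n` are the successive completions of arms. They are read off the colors by an automaton
(`RenewalTracker`) that remembers the arm and the index on it. `RenewalTracker.linearizes` reduces
the probabilistic claim to two finite certificates: a nonnegative function with drift at most `-1`,
which gives finite mean, and harmonic functions with prescribed terminal values, which give the law
of the displacement. `LoopSystem.linearizes_walk` supplies both: a quadratic function of the index,
and a linear interpolation along each arm. Independence comes from the strong Markov property
`measureReal_inter_hit`, which makes the joint law of the excursions a product in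
`measureReal_excursion_eq`. -/

/-! ### The Markov property over the events of the past -/

section MarkovProperty

variable {Ω E : Type*} [mΩ : MeasurableSpace Ω] [MeasurableSpace E]

/-- An event of the past up to time `n` is determined by the values of `Y 0, …, Y n`. -/
theorem exists_preimage_of_measurableSet_processFiltration {Y : ℕ → Ω → E}
    (hY : ∀ n, Measurable (Y n)) {n : ℕ} {A : Set Ω}
    (hA : MeasurableSet[processFiltration Y hY n] A) :
    ∃ B : Set (Finset.Iic n → E), A = (fun ω (i : Finset.Iic n) => Y i ω) ⁻¹' B := by
  have hle : (processFiltration Y hY n : MeasurableSpace Ω) ≤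
      MeasurableSpace.comap (fun ω (i : Finset.Iic n) => Y i ω) ⊤ := by
    refine iSup₂_le fun i hi => ?_
    rintro _ ⟨s, -, rfl⟩
    exact ⟨{x | x ⟨i, Finset.mem_Iic.2 hi⟩ ∈ s}, trivial, rfl⟩
  obtain ⟨B, -, h⟩ := hle A hA
  exact ⟨B, h.symm⟩

theorem measurableSet_processFiltration_preimage {Y : ℕ → Ω → E} (hY : ∀ n, Measurable (Y n))
    {i n : ℕ} (hi : i ≤ n) {s : Set E} (hs : MeasurableSet s) :
    MeasurableSet[processFiltration Y hY n] (Y i ⁻¹' s) :=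
  (le_iSup₂_of_le (f := fun j (_ : j ≤ n) => MeasurableSpace.comap (Y j) _) i hi le_rfl :
    MeasurableSpace.comap (Y i) _ ≤ processFiltration Y hY n) _ ⟨s, hs, rfl⟩

/-- The Markov property: given an event of the past on which `Y n = x`, the next value is `y` with
probability `Q x y`. -/
theorem IsMarkovChain.measure_inter_inter [Countable E] [DiscreteMeasurableSpace E]
    {Q : E → E → ℝ} (hQ : ∀ x y, 0 ≤ Q x y) {x₀ : E}
    {Y : ℕ → Ω → E} {μ : Measure Ω} (hY : IsMarkovChain Q x₀ Y μ) {n : ℕ} {A : Set Ω}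
    (hA : MeasurableSet[processFiltration Y hY.measurable n] A) (x y : E) :
    μ (A ∩ {ω | Y n ω = x} ∩ {ω | Y (n + 1) ω = y}) =
      μ (A ∩ {ω | Y n ω = x}) * ENNReal.ofReal (Q x y) := by
  have := hY.isProbabilityMeasure
  have hA' : MeasurableSet[processFiltration Y hY.measurable n] (A ∩ {ω | Y n ω = x}) :=
    hA.inter (measurableSet_processFiltration_preimage hY.measurable le_rfl
      (measurableSet_singleton x))
  obtain ⟨B, hB⟩ := exists_preimage_of_measurableSet_processFiltration hY.measurable hA'
  have hx : ∀ b ∈ B, ∀ ω, (fun i : Finset.Iic n => Y i ω) = b → Y n ω = x := by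
    rintro b hb ω rfl
    have : ω ∈ A ∩ {ω | Y n ω = x} := by rw [hB]; exact hb
    exact this.2
  -- Since `E` is countable, the past event is a countable union of cylinders `F ⁻¹' {b}`. It is
  -- enough to prove the identity on each of them and sum.
  set F : Ω → (Finset.Iic n → E) := fun ω i => Y i ω with hF
  have hFm : Measurable F := measurable_pi_lambda _ fun i => hY.measurable i
  have hsing : ∀ b : Finset.Iic n → E, MeasurableSet (F ⁻¹' {b}) := fun b =>
    hFm (measurableSet_singleton b)
  have hcyl : ∀ b ∈ B, μ (F ⁻¹' {b} ∩ {ω | Y (n + 1) ω = y}) =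
      μ (F ⁻¹' {b}) * ENNReal.ofReal (Q x y) := by
    intro b hb
    by_cases hne : ∃ ω, F ω = b
    swap
    · have : F ⁻¹' {b} = ∅ := by
        ext ω; simp only [Set.mem_preimage, Set.mem_singleton_iff, Set.mem_empty_iff_false,
          iff_false]
        exact fun h => hne ⟨ω, h⟩
      simp [this]
    obtain ⟨ω₀, h₀⟩ := hne
    -- The test path follows a point `ω₀` of the cylinder up to time `n` and then takes the value
    -- `y`.
    have hs := hY.step n (fun i => if i ≤ n then Y i ω₀ else y)
    have e1 : {ω | ∀ i ≤ n + 1, Y i ω = if i ≤ n then Y i ω₀ else y} =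
        F ⁻¹' {b} ∩ {ω | Y (n + 1) ω = y} := by
      ext ω
      simp only [← h₀, hF, Set.mem_ofPred_eq, Set.mem_inter_iff, Set.mem_preimage,
        Set.mem_singleton_iff, funext_iff, Subtype.forall, Finset.mem_Iic]
      constructor
      · intro h
        exact ⟨fun i hi => by simpa [hi] using h i (by omega), by simpa using h (n + 1) le_rfl⟩
      · rintro ⟨h1, h2⟩ i hi
        rcases Nat.le_succ_iff.1 hi with hi | rfl
        · simpa [hi] using h1 i hi
        · simpa using h2
    have e2 : {ω | ∀ i ≤ n, Y i ω = if i ≤ n then Y i ω₀ else y} = F ⁻¹' {b} := by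
      ext ω
      simp only [← h₀, hF, Set.mem_ofPred_eq, Set.mem_preimage,
        Set.mem_singleton_iff, funext_iff, Subtype.forall, Finset.mem_Iic]
      exact forall₂_congr fun i hi => by simp [hi]
    rw [e1, e2] at hs
    simp only [le_refl, if_true, Nat.not_succ_le_self, if_false, hx b hb ω₀ h₀] at hs
    rw [← ENNReal.toReal_eq_toReal_iff' (measure_ne_top _ _)
      (ENNReal.mul_ne_top (measure_ne_top _ _) ENNReal.ofReal_ne_top), ENNReal.toReal_mul,
      ENNReal.toReal_ofReal (hQ _ _)]
    exact hs
  have hm1 : MeasurableSet {ω | Y (n + 1) ω = y} :=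
    hY.measurable (n + 1) (measurableSet_singleton y)
  rw [hB, ← tsum_measure_preimage_singleton (Set.to_countable B) fun b _ => hsing b,
    ← Measure.restrict_apply (hFm (Set.to_countable B).measurableSet),
    ← tsum_measure_preimage_singleton (Set.to_countable B) fun b _ => hsing b,
    ← ENNReal.tsum_mul_right]
  exact tsum_congr fun b => by rw [Measure.restrict_apply (hsing _), hcyl b b.2]

end MarkovProperty

/-! ### The chain of colors of a colored walk -/

namespace ColoredWalk

section ColorMatrix

variable {G : Type*} {r : ℕ}

theorem hasSum_p_apply (W : ColoredWalk G r) (u v : Fin r) :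
    HasSum (fun g => W.p g u v) (W.colorMatrix u v) :=
  Pi.hasSum.1 (Pi.hasSum.1 W.summable.hasSum u) v

theorem colorMatrix_nonneg (W : ColoredWalk G r) (u v : Fin r) : 0 ≤ W.colorMatrix u v :=
  (W.hasSum_p_apply u v).nonneg fun g => W.nonneg g u v

theorem p_eq_zero_of_colorMatrix_eq_zero (W : ColoredWalk G r) {u v : Fin r}
    (h : W.colorMatrix u v = 0) (g : G) : W.p g u v = 0 :=
  congrFun ((hasSum_zero_iff_of_nonneg fun g => W.nonneg g u v).1 (h ▸ W.hasSum_p_apply u v)) g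

theorem exists_p_ne_zero (W : ColoredWalk G r) {u v : Fin r} (h : W.colorMatrix u v ≠ 0) :
    ∃ g, W.p g u v ≠ 0 := by
  by_contra! h'
  exact h ((W.hasSum_p_apply u v).unique (by simp [h', hasSum_zero]))

end ColorMatrix

variable {G : Type*} [Group G] {r : ℕ}

theorem kernel_nonneg (W : ColoredWalk G r) (x y : G × Fin r) : 0 ≤ W.kernel x y :=
  W.nonneg _ _ _

variable {Ω : Type*} [MeasurableSpace Ω] [MeasurableSpace G] [Countable G]
  [DiscreteMeasurableSpace G] {μ : Measure Ω} {x₀ : G × Fin r}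

/-- The colors of a colored walk evolve according to the matrix `P`, given the past of the walk. -/
theorem measureReal_inter_color_eq (W : ColoredWalk G r) {Y : ℕ → Ω → G × Fin r}
    (hY : IsMarkovChain W.kernel x₀ Y μ) {n : ℕ} {A : Set Ω}
    (hA : MeasurableSet[processFiltration Y hY.measurable n] A) {u : Fin r}
    (hu : ∀ᵐ ω ∂μ, ω ∈ A → (Y n ω).2 = u) (v : Fin r) :
    μ.real (A ∩ {ω | (Y (n + 1) ω).2 = v}) = μ.real A * W.colorMatrix u v := by
  have := hY.isProbabilityMeasure
  have hAm : MeasurableSet A := (processFiltration Y hY.measurable).le n _ hA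
  -- The color at time `n` is `u` only almost surely on `A`; `C` is the part of `A` where it holds
  -- everywhere. The Markov property is then summed over both group coordinates, and translation
  -- invariance makes the inner sum independent of `g`.
  set C : Set Ω := A ∩ {ω | (Y n ω).2 = u} with hC
  have hAC : A =ᵐ[μ] C := by
    filter_upwards [hu] with ω hω
    exact propext ⟨fun h => ⟨h, hω h⟩, fun h => h.1⟩
  have hv' : MeasurableSet {ω | (Y (n + 1) ω).2 = v} :=
    (measurable_snd.comp (hY.measurable (n + 1))) (measurableSet_singleton v)
  have hdec : ∀ D : Set Ω, MeasurableSet D →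
      μ (C ∩ D) = ∑' g : G, μ (A ∩ {ω | Y n ω = (g, u)} ∩ D) := by
    intro D hD
    rw [← measure_iUnion]
    · congr 1; ext ω
      simp only [hC, Set.mem_inter_iff, Set.mem_ofPred_eq, Set.mem_iUnion, Prod.ext_iff]
      constructor
      · rintro ⟨⟨h1, h2⟩, h3⟩; exact ⟨_, ⟨h1, rfl, h2⟩, h3⟩
      · rintro ⟨g, ⟨h1, -, h2⟩, h3⟩; exact ⟨⟨h1, h2⟩, h3⟩
    · intro g g' hgg'
      refine Set.disjoint_left.2 fun ω h h' => hgg' ?_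
      have h1 : Y n ω = (g, u) := h.1.2
      have h2 : Y n ω = (g', u) := h'.1.2
      exact congrArg Prod.fst (h1.symm.trans h2)
    · exact fun g => (hAm.inter (hY.measurable n (measurableSet_singleton _))).inter hD
  have hdec' : ∀ D : Set Ω, MeasurableSet D →
      μ (D ∩ {ω | (Y (n + 1) ω).2 = v}) = ∑' h : G, μ (D ∩ {ω | Y (n + 1) ω = (h, v)}) := by
    intro D hD
    rw [← measure_iUnion]
    · congr 1; ext ω
      simp only [Set.mem_inter_iff, Set.mem_ofPred_eq, Set.mem_iUnion, Prod.ext_iff]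
      constructor
      · rintro ⟨h1, h2⟩; exact ⟨_, h1, rfl, h2⟩
      · rintro ⟨g, h1, -, h2⟩; exact ⟨h1, h2⟩
    · intro g g' hgg'
      refine Set.disjoint_left.2 fun ω h h' => hgg' ?_
      have h1 : Y (n + 1) ω = (g, v) := h.2
      have h2 : Y (n + 1) ω = (g', v) := h'.2
      exact congrArg Prod.fst (h1.symm.trans h2)
    · exact fun g => hD.inter (hY.measurable (n + 1) (measurableSet_singleton _))
  have hsum : ∀ g : G, ∑' h : G, ENNReal.ofReal (W.kernel (g, u) (h, v)) =
      ENNReal.ofReal (W.colorMatrix u v) := by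
    intro g
    have h3 : HasSum (fun h => W.kernel (g, u) (h, v)) (W.colorMatrix u v) :=
      (Equiv.mulLeft g⁻¹).hasSum_iff.2 (W.hasSum_p_apply u v)
    rw [← h3.tsum_eq, ENNReal.ofReal_tsum_of_nonneg (fun h => W.kernel_nonneg _ _) h3.summable]
  have key : μ (C ∩ {ω | (Y (n + 1) ω).2 = v}) = μ C * ENNReal.ofReal (W.colorMatrix u v) := by
    have hCuniv := hdec Set.univ MeasurableSet.univ
    simp only [Set.inter_univ] at hCuniv
    rw [hdec _ hv', hCuniv,
      ← ENNReal.tsum_mul_right]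
    refine tsum_congr fun g => ?_
    have hg : MeasurableSet (A ∩ {ω | Y n ω = (g, u)}) :=
      hAm.inter (hY.measurable n (measurableSet_singleton _))
    rw [hdec' _ hg, ← hsum g,
      ← ENNReal.tsum_mul_left]
    exact tsum_congr fun h => hY.measure_inter_inter W.kernel_nonneg hA _ _
  have hAC' : (A ∩ {ω | (Y (n + 1) ω).2 = v} : Set Ω) =ᵐ[μ]
      (C ∩ {ω | (Y (n + 1) ω).2 = v} : Set Ω) :=
    hAC.inter (ae_eq_refl _)
  rw [measureReal_congr hAC, measureReal_congr hAC', measureReal_def, key,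
    ENNReal.toReal_mul, ENNReal.toReal_ofReal (W.colorMatrix_nonneg u v), measureReal_def]

/-- Almost surely, every transition made by the walk has positive probability. -/
theorem ae_kernel_ne_zero (W : ColoredWalk G r) {Y : ℕ → Ω → G × Fin r}
    (hY : IsMarkovChain W.kernel x₀ Y μ) :
    ∀ᵐ ω ∂μ, ∀ n, W.kernel (Y n ω) (Y (n + 1) ω) ≠ 0 := by
  refine ae_all_iff.2 fun n => ?_
  have h : ∀ x y : G × Fin r, ∀ᵐ ω ∂μ, W.kernel x y = 0 → ¬ (Y n ω = x ∧ Y (n + 1) ω = y) := by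
    intro x y
    by_cases hxy : W.kernel x y = 0
    · have := hY.measure_inter_inter W.kernel_nonneg
        (n := n) (MeasurableSet.univ) x y
      rw [hxy] at this
      simp only [Set.univ_inter, ENNReal.ofReal_zero, mul_zero] at this
      filter_upwards [measure_eq_zero_iff_ae_notMem.1 this] with ω hω _ h'
      exact hω h'
    · exact Filter.Eventually.of_forall fun ω h => absurd h hxy
  filter_upwards [ae_all_iff.2 fun x => ae_all_iff.2 (h x)] with ω hω h0
  exact hω _ _ h0 ⟨rfl, rfl⟩

end ColoredWalk

/-! ### Excursions of a colored walk recorded by an automaton -/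

/-- An automaton that reads the colors of a colored walk. It starts at `root`, and it is sent back
to `root` after each visit to a terminal state. Between two such renewals, its state determines the
color of the walk and the displacement in `G` since the last renewal. -/
structure RenewalTracker {G : Type*} [Group G] {r : ℕ} [NeZero r] (W : ColoredWalk G r)
    (Z : Type*) where
  root : Z
  live : Set Z
  terminal : Set Z
  next : Z → Fin r → Z
  color : Z → Fin r
  disp : Z → G
  root_mem : root ∈ live
  color_root : color root = 0
  disp_root : disp root = 1
  notMem_terminal : ∀ z ∈ live, z ∉ terminal
  color_terminal : ∀ z ∈ terminal, color z = 0
  next_mem : ∀ z ∈ live, ∀ h v, W.p h (color z) v ≠ 0 → next z v ∈ live ∪ terminal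
  color_next : ∀ z ∈ live, ∀ h v, W.p h (color z) v ≠ 0 → color (next z v) = v
  disp_next : ∀ z ∈ live, ∀ h v, W.p h (color z) v ≠ 0 → disp (next z v) = disp z * h

namespace RenewalTracker

variable {G : Type*} [Group G] {r : ℕ} [NeZero r] {W : ColoredWalk G r} {Z : Type*}
  (R : RenewalTracker W Z)

/-! ### Renewal times along a fixed trajectory -/

section Path

open Classical in
/-- Send terminal states to the root. -/
noncomputable def reset (z : Z) : Z := if z ∈ R.terminal then R.root else z

/-- The state of the automaton at each time along a trajectory of the walk. -/
noncomputable def state (y : ℕ → G × Fin r) : ℕ → Z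
  | 0 => R.root
  | m + 1 => R.next (R.reset (state y m)) (y (m + 1)).2

open Classical in
/-- The number of renewals up to time `m`. -/
noncomputable def count (y : ℕ → G × Fin r) : ℕ → ℕ
  | 0 => 0
  | m + 1 => count y m + if R.state y (m + 1) ∈ R.terminal then 1 else 0

open Classical in
/-- The time of the `n`-th renewal. -/
noncomputable def time (n : ℕ) (y : ℕ → G × Fin r) : WithTop ℕ :=
  if h : ∃ m, n ≤ R.count y m then ((Nat.find h : ℕ) : WithTop ℕ) else ⊤

/-- The walk starts at `(e, 1)` and all its transitions have positive probability. -/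
structure IsAdmissible (W : ColoredWalk G r) (y : ℕ → G × Fin r) : Prop where
  init : y 0 = (1, 0)
  step : ∀ n, W.kernel (y n) (y (n + 1)) ≠ 0

variable {R} {y : ℕ → G × Fin r}

theorem reset_of_mem {z : Z} (h : z ∈ R.terminal) : R.reset z = R.root := if_pos h

theorem reset_of_notMem {z : Z} (h : z ∉ R.terminal) : R.reset z = z := if_neg h

theorem reset_root : R.reset R.root = R.root := reset_of_notMem (R.notMem_terminal _ R.root_mem)

theorem reset_mem_live {z : Z} (h : z ∈ R.live ∪ R.terminal) : R.reset z ∈ R.live := by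
  by_cases hz : z ∈ R.terminal
  · rw [reset_of_mem hz]; exact R.root_mem
  · rw [reset_of_notMem hz]; exact h.resolve_right hz

theorem color_reset (z : Z) : R.color (R.reset z) = R.color z := by
  by_cases hz : z ∈ R.terminal
  · rw [reset_of_mem hz, R.color_root, R.color_terminal z hz]
  · rw [reset_of_notMem hz]

/-- Resetting does not disturb the color, because the root and every terminal state have color `0`.
The transition actually made is therefore one allowed from the reset state, and the axioms of the
automaton apply at each step. -/
theorem IsAdmissible.state_mem_and_color (hy : IsAdmissible W y) (m : ℕ) :
    R.state y m ∈ R.live ∪ R.terminal ∧ R.color (R.state y m) = (y m).2 := by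
  induction m with
  | zero => exact ⟨Or.inl R.root_mem, by simp [state, R.color_root, hy.init]⟩
  | succ m ih =>
    have hl := reset_mem_live ih.1
    have hs := hy.step m
    rw [ColoredWalk.kernel, ← ih.2, ← color_reset] at hs
    exact ⟨R.next_mem _ hl _ _ hs, R.color_next _ hl _ _ hs⟩

theorem IsAdmissible.disp_state_succ (hy : IsAdmissible W y) (m : ℕ) :
    R.disp (R.state y (m + 1)) =
      R.disp (R.reset (R.state y m)) * ((y m).1⁻¹ * (y (m + 1)).1) := by
  have ih := hy.state_mem_and_color (R := R) m
  have hs := hy.step m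
  rw [ColoredWalk.kernel, ← ih.2, ← color_reset] at hs
  exact R.disp_next _ (reset_mem_live ih.1) _ _ hs

/-- After a renewal and until the next one, the automaton records the displacement. -/
theorem IsAdmissible.disp_state (hy : IsAdmissible W y) {m : ℕ}
    (hm : R.reset (R.state y m) = R.root) (t : ℕ)
    (ht : ∀ j < t, R.state y (m + 1 + j) ∉ R.terminal) :
    R.disp (R.state y (m + 1 + t)) = (y m).1⁻¹ * (y (m + 1 + t)).1 := by
  induction t with
  | zero => rw [add_zero, hy.disp_state_succ, hm, R.disp_root, one_mul]
  | succ t ih =>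
    have h1 := ih fun j hj => ht j (by omega)
    rw [← add_assoc, hy.disp_state_succ, reset_of_notMem (ht t (by omega)), h1]
    group

theorem count_mono : Monotone (R.count y) :=
  monotone_nat_of_le_succ fun m => by simp [count]

theorem count_succ_le (m : ℕ) : R.count y (m + 1) ≤ R.count y m + 1 := by
  simp only [count]; split_ifs <;> omega

/-- This adjunction between `time` and `count` reduces statements about renewal times to the
counting function, which is monotone with jumps of size at most one. -/
theorem time_le_iff {n m : ℕ} : R.time n y ≤ m ↔ n ≤ R.count y m := by
  classical
  unfold time
  split_ifs with h
  · rw [Nat.cast_le]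
    exact ⟨fun h' => (Nat.find_spec h).trans (count_mono h'), fun h' => Nat.find_min' h h'⟩
  · simp only [top_le_iff, WithTop.natCast_ne_top, false_iff]
    exact fun h' => h ⟨m, h'⟩

@[simp]
theorem time_zero : R.time 0 y = 0 := by
  have : R.time 0 y ≤ ((0 : ℕ) : WithTop ℕ) := time_le_iff.2 (Nat.zero_le _)
  exact le_antisymm (by simpa using this) bot_le

theorem count_of_time_eq {n m : ℕ} (h : R.time n y = m) : R.count y m = n := by
  have h1 : n ≤ R.count y m := time_le_iff.1 h.le
  refine le_antisymm ?_ h1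
  cases m with
  | zero => simp [count]
  | succ m =>
    have h2 : ¬ n ≤ R.count y m := fun h' => by
      have := time_le_iff.2 h'
      rw [h, Nat.cast_le] at this
      omega
    have := count_succ_le (R := R) (y := y) m
    omega

/-- Only positive times are covered: the time `0` is the renewal of index `0`, although the root is
not terminal. -/
theorem time_eq_succ_iff {n m : ℕ} :
    R.time n y = ((m + 1 : ℕ) : WithTop ℕ) ↔ R.count y (m + 1) = n ∧
      R.state y (m + 1) ∈ R.terminal := by
  constructor
  · intro h
    refine ⟨count_of_time_eq h, ?_⟩
    by_contra h'
    have h1 := count_of_time_eq h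
    simp only [count, h', if_false, add_zero] at h1
    have := time_le_iff.2 h1.ge
    rw [h, Nat.cast_le] at this
    omega
  · rintro ⟨h1, h2⟩
    refine le_antisymm (time_le_iff.2 h1.ge) (le_of_not_gt fun h3 => ?_)
    have h4 : R.time n y ≤ m := by
      obtain ⟨k, hk⟩ := WithTop.ne_top_iff_exists.1 h3.ne_top
      rw [← hk] at h3 ⊢
      have : k < m + 1 := WithTop.coe_lt_coe.1 h3
      have hkm : k ≤ m := by omega
      exact WithTop.coe_le_coe.2 hkm
    have h5 := time_le_iff.1 h4
    simp only [count, h2, if_true] at h1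
    omega

theorem reset_state_of_time_eq {n m : ℕ} (h : R.time n y = m) :
    R.reset (R.state y m) = R.root := by
  cases m with
  | zero => exact reset_root
  | succ m => exact reset_of_mem (time_eq_succ_iff.1 h).2

theorem count_add_eq_iff (m t : ℕ) :
    R.count y (m + t) = R.count y m ↔ ∀ j < t, R.state y (m + 1 + j) ∉ R.terminal := by
  induction t with
  | zero => simp
  | succ t ih =>
    rw [Nat.forall_lt_succ_right, ← ih, ← add_assoc, show m + 1 + t = m + t + 1 by ring]
    have := count_mono (R := R) (y := y) (Nat.le_add_right m t)
    simp only [count]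
    split_ifs with h <;> simp [h]
    omega

/-- The next renewal time in terms of the states of the automaton. -/
theorem time_succ_eq_iff {n m : ℕ} (h : R.time n y = m) (t : ℕ) :
    R.time (n + 1) y = ((m + 1 + t : ℕ) : WithTop ℕ) ↔
      (∀ j < t, R.state y (m + 1 + j) ∉ R.terminal) ∧ R.state y (m + 1 + t) ∈ R.terminal := by
  rw [show m + 1 + t = m + t + 1 by ring, time_eq_succ_iff, ← count_add_eq_iff,
    count_of_time_eq h]
  simp only [count]
  refine and_congr_left fun h1 => ?_
  simp [h1]

theorem lt_time_succ_iff {n m : ℕ} (h : R.time n y = m) (t : ℕ) :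
    ((m + t : ℕ) : WithTop ℕ) < R.time (n + 1) y ↔
      ∀ j < t, R.state y (m + 1 + j) ∉ R.terminal := by
  rw [← not_le, time_le_iff, ← count_add_eq_iff, count_of_time_eq h]
  have := count_mono (R := R) (y := y) (Nat.le_add_right m t)
  rw [count_of_time_eq h] at this
  omega

theorem time_lt_time_succ {n : ℕ} (h : R.time n y ≠ ⊤) : R.time n y < R.time (n + 1) y := by
  obtain ⟨m, hm⟩ := WithTop.ne_top_iff_exists.1 h
  have := (lt_time_succ_iff hm.symm 0).2 (by simp)
  rw [← hm]
  exact this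

end Path

/-! ### Excursion probabilities, Lyapunov bound and harmonic functions -/

section HitProb

open Classical in
/-- The probability that, starting from the state `z`, the automaton has its `(t+1)`-st state in
`D` and none of its first `t` states terminal. -/
noncomputable def hitProb (D : Set Z) : ℕ → Z → ℝ
  | 0, z => ∑ v, W.colorMatrix (R.color z) v * if R.next z v ∈ D then 1 else 0
  | t + 1, z => ∑ v, W.colorMatrix (R.color z) v *
      if R.next z v ∈ R.terminal then 0 else hitProb D t (R.next z v)

variable {R}

theorem hitProb_nonneg (D : Set Z) (t : ℕ) (z : Z) : 0 ≤ R.hitProb D t z := by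
  induction t generalizing z with
  | zero =>
    exact Finset.sum_nonneg fun v _ => mul_nonneg (W.colorMatrix_nonneg _ _)
      (by split_ifs <;> norm_num)
  | succ t ih =>
    exact Finset.sum_nonneg fun v _ => mul_nonneg (W.colorMatrix_nonneg _ _)
      (by split_ifs; exacts [le_rfl, ih _])

theorem next_mem_of_colorMatrix_ne_zero {z : Z} (hz : z ∈ R.live) {v : Fin r}
    (h : W.colorMatrix (R.color z) v ≠ 0) : R.next z v ∈ R.live ∪ R.terminal := by
  obtain ⟨g, hg⟩ := W.exists_p_ne_zero h
  exact R.next_mem z hz g v hg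

/-- A color whose transition leads outside `live ∪ terminal` has weight zero, so `f` and `H` need to
be controlled on these states only. -/
theorem sum_colorMatrix_mul_le {z : Z} (hz : z ∈ R.live) {φ ψ : Fin r → ℝ}
    (h : ∀ v, R.next z v ∈ R.live ∪ R.terminal → φ v ≤ ψ v) :
    ∑ v, W.colorMatrix (R.color z) v * φ v ≤ ∑ v, W.colorMatrix (R.color z) v * ψ v := by
  refine Finset.sum_le_sum fun v _ => ?_
  by_cases hv : W.colorMatrix (R.color z) v = 0
  · simp [hv]
  · exact mul_le_mul_of_nonneg_left (h v (next_mem_of_colorMatrix_ne_zero hz hv))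
      (W.colorMatrix_nonneg _ _)

/-- A nonnegative function with drift at most `-1` bounds the expected duration of an excursion. -/
theorem sum_hitProb_compl_le {f : Z → ℝ} (hf : ∀ z ∈ R.live ∪ R.terminal, 0 ≤ f z)
    (hdrift : ∀ z ∈ R.live, ∑ v, W.colorMatrix (R.color z) v * f (R.next z v) ≤ f z - 1)
    (n : ℕ) {z : Z} (hz : z ∈ R.live) :
    1 + ∑ t ∈ Finset.range n, R.hitProb R.terminalᶜ t z ≤ f z := by
  induction n generalizing z with
  | zero =>
    have h := sum_colorMatrix_mul_le (R := R) hz (φ := fun _ => 0) fun v hv => hf _ hv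
    simp only [mul_zero, Finset.sum_const_zero] at h
    simp only [Finset.range_zero, Finset.sum_empty]
    linarith [hdrift z hz]
  | succ n ih =>
    classical
    -- First-step decomposition: the term `t = 0` becomes the `1` in the bound for the next state.
    have h : ∑ t ∈ Finset.range (n + 1), R.hitProb R.terminalᶜ t z =
        ∑ v, W.colorMatrix (R.color z) v * if R.next z v ∈ R.terminal then 0 else
          1 + ∑ t ∈ Finset.range n, R.hitProb R.terminalᶜ t (R.next z v) := by
      rw [Finset.sum_range_succ']
      simp only [hitProb]
      rw [Finset.sum_comm, ← Finset.sum_add_distrib]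
      refine Finset.sum_congr rfl fun v _ => ?_
      rw [← Finset.mul_sum, ← mul_add]
      by_cases hv : R.next z v ∈ R.terminal <;> simp [hv, add_comm]
    rw [h]
    have h2 := sum_colorMatrix_mul_le (R := R) hz (φ := fun v => if R.next z v ∈ R.terminal then 0
      else 1 + ∑ t ∈ Finset.range n, R.hitProb R.terminalᶜ t (R.next z v))
      (ψ := fun v => f (R.next z v)) fun v hv => by
        split_ifs with hT
        · exact hf _ hv
        · exact ih (hv.resolve_right hT)
    linarith [hdrift z hz]

theorem summable_hitProb_compl {f : Z → ℝ} (hf : ∀ z ∈ R.live ∪ R.terminal, 0 ≤ f z)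
    (hdrift : ∀ z ∈ R.live, ∑ v, W.colorMatrix (R.color z) v * f (R.next z v) ≤ f z - 1)
    {z : Z} (hz : z ∈ R.live) : Summable fun t => R.hitProb R.terminalᶜ t z :=
  summable_of_sum_range_le (c := f z) (fun t => hitProb_nonneg _ t z) fun n => by
    linarith [sum_hitProb_compl_le hf hdrift n hz]

open Classical in
/-- A harmonic function with values in `[0, 1]` is the probability of a terminal set, up to the
probability that the excursion is not over. -/
theorem sum_hitProb_le_harmonic {D : Set Z} (hD : D ⊆ R.terminal) {H : Z → ℝ}
    (hH0 : ∀ z ∈ R.live, 0 ≤ H z) (hH1 : ∀ z ∈ R.live, H z ≤ 1)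
    (hHT : ∀ z ∈ R.terminal, H z = if z ∈ D then 1 else 0)
    (hharm : ∀ z ∈ R.live, ∑ v, W.colorMatrix (R.color z) v * H (R.next z v) = H z)
    (n : ℕ) {z : Z} (hz : z ∈ R.live) :
    ∑ t ∈ Finset.range (n + 1), R.hitProb D t z ≤ H z ∧
      H z ≤ ∑ t ∈ Finset.range (n + 1), R.hitProb D t z + R.hitProb R.terminalᶜ n z := by
  induction n generalizing z with
  | zero =>
    simp only [zero_add, Finset.sum_range_one, hitProb]
    rw [← Finset.sum_add_distrib]
    simp only [← mul_add]
    rw [← hharm z hz]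
    constructor <;> refine sum_colorMatrix_mul_le hz fun v hv => ?_
    · rcases hv with hv | hv
      · rw [if_neg fun h => R.notMem_terminal _ hv (hD h)]; exact hH0 _ hv
      · exact (hHT _ hv).ge
    · rcases hv with hv | hv
      · have h := R.notMem_terminal _ hv
        rw [if_neg fun h' => h (hD h')]
        simpa [h] using hH1 _ hv
      · simp [hHT _ hv, hv]
  | succ n ih =>
    have h : ∑ t ∈ Finset.range (n + 1 + 1), R.hitProb D t z =
        ∑ v, W.colorMatrix (R.color z) v * ((if R.next z v ∈ D then 1 else 0) +
          if R.next z v ∈ R.terminal then 0 else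
            ∑ t ∈ Finset.range (n + 1), R.hitProb D t (R.next z v)) := by
      rw [Finset.sum_range_succ']
      simp only [hitProb]
      rw [Finset.sum_comm, ← Finset.sum_add_distrib]
      refine Finset.sum_congr rfl fun v _ => ?_
      rw [← Finset.mul_sum, ← mul_add]
      by_cases hv : R.next z v ∈ R.terminal <;> simp [hv, add_comm]
    rw [h, hitProb, ← Finset.sum_add_distrib]
    simp only [← mul_add]
    rw [← hharm z hz]
    constructor <;> refine sum_colorMatrix_mul_le hz fun v hv => ?_
    · rcases hv with hv | hv
      · have h := R.notMem_terminal _ hv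
        rw [if_neg fun h' => h (hD h'), if_neg h, zero_add]
        exact (ih hv).1
      · simp [hHT _ hv, hv]
    · rcases hv with hv | hv
      · have h := R.notMem_terminal _ hv
        rw [if_neg fun h' => h (hD h'), if_neg h, if_neg h, zero_add]
        exact (ih hv).2
      · simp [hHT _ hv, hv]

-- The partial sums are squeezed between `H z` and `H z` minus the survival probability. The latter
-- is summable by the Lyapunov bound and so tends to zero.
open Classical in
theorem hasSum_hitProb {D : Set Z} (hD : D ⊆ R.terminal) {H f : Z → ℝ}
    (hH0 : ∀ z ∈ R.live, 0 ≤ H z) (hH1 : ∀ z ∈ R.live, H z ≤ 1)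
    (hHT : ∀ z ∈ R.terminal, H z = if z ∈ D then 1 else 0)
    (hharm : ∀ z ∈ R.live, ∑ v, W.colorMatrix (R.color z) v * H (R.next z v) = H z)
    (hf : ∀ z ∈ R.live ∪ R.terminal, 0 ≤ f z)
    (hdrift : ∀ z ∈ R.live, ∑ v, W.colorMatrix (R.color z) v * f (R.next z v) ≤ f z - 1)
    {z : Z} (hz : z ∈ R.live) : HasSum (fun t => R.hitProb D t z) (H z) := by
  rw [hasSum_iff_tendsto_nat_of_nonneg (fun t => hitProb_nonneg _ t z)]
  rw [← Filter.tendsto_add_atTop_iff_nat 1]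
  have h0 := (summable_hitProb_compl hf hdrift hz).tendsto_atTop_zero
  have hb := fun n => sum_hitProb_le_harmonic hD hH0 hH1 hHT hharm n hz
  have h1 : Filter.Tendsto (fun n => H z - R.hitProb R.terminalᶜ n z) Filter.atTop
      (nhds (H z)) := by simpa using h0.const_sub (H z)
  exact tendsto_of_tendsto_of_tendsto_of_le_of_le h1 tendsto_const_nhds
    (fun n => by linarith [(hb n).2]) fun n => (hb n).1

end HitProb

end RenewalTracker

/-! ### Independence from the joint probabilities -/

theorem measureReal_eq_sum_inter {Ω ι : Type*} [MeasurableSpace Ω] [Fintype ι] {μ : Measure Ω}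
    [IsFiniteMeasure μ] {A : Set Ω} (hA : MeasurableSet A) {f : Ω → ι}
    (hf : ∀ v, MeasurableSet {ω | f ω = v}) :
    μ.real A = ∑ v, μ.real (A ∩ {ω | f ω = v}) := by
  rw [← measureReal_biUnion_finset]
  · congr 1; ext ω; simp
  · intro v _ v' _ hvv'
    exact Set.disjoint_left.2 fun ω h h' => hvv' (h.2.symm.trans h'.2)
  · exact fun v _ => hA.inter (hf v)

/-- A sequence with values in a countable set whose joint probabilities are products is independent
and identically distributed. -/
theorem iIndepFun_and_identDistrib_of_measureReal_eq_prod {Ω α : Type*} [MeasurableSpace Ω]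
    [MeasurableSpace α] [Countable α] [MeasurableSingletonClass α] {μ : Measure Ω}
    [IsProbabilityMeasure μ] {X : ℕ → Ω → α} (hX : ∀ n, Measurable (X n)) {q : α → ℝ}
    (hq : ∀ (n : ℕ) (x : ℕ → α),
      μ.real {ω | ∀ i < n, X i ω = x i} = ∏ i ∈ Finset.range n, q (x i)) :
    iIndepFun X μ ∧ ∀ n, IdentDistrib (X n) (X 0) μ μ := by
  obtain ⟨ω₀⟩ : Nonempty Ω := nonempty_of_isProbabilityMeasure μ
  have hν : ∀ x, (μ.map (X 0)).real {x} = q x := fun x => by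
    have h := hq 1 fun _ => x
    simp only [Nat.lt_one_iff, forall_eq, Finset.range_one, Finset.prod_singleton] at h
    rw [map_measureReal_apply (hX 0) (measurableSet_singleton x), ← h]
    rfl
  have : IsProbabilityMeasure (μ.map (X 0)) := Measure.isProbabilityMeasure_map (hX 0).aemeasurable
  have hV : ∀ n, Measurable fun ω (i : Fin n) => X i ω := fun n =>
    measurable_pi_lambda _ fun i => hX i
  have hpi : ∀ n, μ.map (fun ω (i : Fin n) => X i ω) = Measure.pi fun _ => μ.map (X 0) := by
    intro n
    have := Measure.isProbabilityMeasure_map (μ := μ) (hV n).aemeasurable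
    refine Measure.ext_of_singleton fun x => ?_
    rw [Measure.pi_singleton, ← ENNReal.toReal_eq_toReal_iff' (measure_ne_top _ _)
      (ENNReal.prod_ne_top fun i _ => measure_ne_top _ _), ENNReal.toReal_prod]
    change (μ.map _).real {x} = ∏ i, (μ.map (X 0)).real {x i}
    simp only [hν]
    -- `hq` expects an infinite sequence; the terms from index `n` on are arbitrary, and `X 0 ω₀`
    -- serves as a filler.
    have h := hq n fun i => if h : i < n then x ⟨i, h⟩ else X 0 ω₀
    rw [Finset.prod_range] at h
    simp only [Fin.is_lt, dite_true, Fin.eta] at h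
    rw [map_measureReal_apply (hV n) (measurableSet_singleton x), ← h]
    congr 1; ext ω
    simp only [Set.mem_preimage, Set.mem_singleton_iff, funext_iff, Set.mem_ofPred_eq,
      Fin.forall_iff]
    exact forall₂_congr fun i hi => by simp [hi]
  have hid : ∀ n, μ.map (X n) = μ.map (X 0) := by
    intro n
    have h := (measurePreserving_eval (fun _ : Fin (n + 1) => μ.map (X 0)) (Fin.last n)).map_eq
    rw [← hpi (n + 1), Measure.map_map (measurable_pi_apply _) (hV _)] at h
    exact h
  refine ⟨iIndepFun_iff_finset.2 fun s => ?_, fun n =>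
    ⟨(hX n).aemeasurable, (hX 0).aemeasurable, hid n⟩⟩
  -- A finite set of indices lies in an initial segment, on which the joint law is already known to
  -- be a product.
  have h : iIndepFun (fun i : Fin (s.sup id + 1) => X i) μ := by
    rw [iIndepFun_iff_map_fun_eq_pi_map (f := fun i : Fin (s.sup id + 1) => X i)
      fun i => (hX i).aemeasurable, hpi]
    simp only [hid]
  refine h.precomp (g := fun i : s => (⟨i.1, Nat.lt_succ_of_le
    (Finset.le_sup (f := id) i.2)⟩ : Fin (s.sup id + 1))) fun i j hij => ?_
  exact Subtype.ext (congrArg Fin.val hij)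

theorem measurableSet_processFiltration_color {G Ω : Type*} [MeasurableSpace G] {r : ℕ}
    [MeasurableSpace Ω] {Y : ℕ → Ω → G × Fin r} (hY : ∀ n, Measurable (Y n)) {i m : ℕ}
    (hi : i ≤ m) (v : Fin r) :
    MeasurableSet[processFiltration Y hY m] {ω | (Y i ω).2 = v} :=
  measurableSet_processFiltration_preimage hY hi (measurable_snd (measurableSet_singleton v))

namespace RenewalTracker

variable {G : Type*} [Group G] [MeasurableSpace G]
  {r : ℕ} [NeZero r] {W : ColoredWalk G r} {Z : Type*}
  {R : RenewalTracker W Z} {Ω : Type*} [MeasurableSpace Ω] {μ : Measure Ω}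
  {Y : ℕ → Ω → G × Fin r}

/-! ### Measurability -/

theorem measurableSet_state (hY : ∀ n, Measurable (Y n)) (m : ℕ) (D : Set Z) :
    MeasurableSet[processFiltration Y hY m] {ω | R.state (fun n => Y n ω) m ∈ D} := by
  induction m generalizing D with
  | zero => simp only [state, MeasurableSet.const]
  | succ m ih =>
    have h : {ω | R.state (fun n => Y n ω) (m + 1) ∈ D} = ⋃ v : Fin r,
        {ω | (Y (m + 1) ω).2 = v} ∩
          {ω | R.state (fun n => Y n ω) m ∈ {z | R.next (R.reset z) v ∈ D}} := by
      ext ω; simp [state]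
    rw [h]
    exact MeasurableSet.iUnion fun v =>
      (measurableSet_processFiltration_color hY le_rfl v).inter
        ((processFiltration Y hY).mono (Nat.le_succ m) _ (ih _))

theorem measurableSet_le_count (hY : ∀ n, Measurable (Y n)) (n m : ℕ) :
    MeasurableSet[processFiltration Y hY m] {ω | n ≤ R.count (fun n => Y n ω) m} := by
  induction m generalizing n with
  | zero => simp only [count, MeasurableSet.const]
  | succ m ih =>
    have h : {ω | n ≤ R.count (fun n => Y n ω) (m + 1)} =
        {ω | n ≤ R.count (fun n => Y n ω) m} ∪ {ω | n - 1 ≤ R.count (fun n => Y n ω) m} ∩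
          {ω | R.state (fun n => Y n ω) (m + 1) ∈ R.terminal} := by
      ext ω
      simp only [count, Set.mem_ofPred_eq, Set.mem_union, Set.mem_inter_iff]
      by_cases h : R.state (fun n => Y n ω) (m + 1) ∈ R.terminal <;> simp [h]
      omega
    rw [h]
    have hmono := (processFiltration Y hY).mono (Nat.le_succ m)
    exact (hmono _ (ih n)).union ((hmono _ (ih _)).inter (measurableSet_state hY (m + 1) _))

theorem isStoppingTime_time (hY : ∀ n, Measurable (Y n)) (n : ℕ) :
    IsStoppingTime (processFiltration Y hY) fun ω => R.time n fun n => Y n ω := by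
  intro m
  have h : {ω | R.time n (fun n => Y n ω) ≤ m} = {ω | n ≤ R.count (fun n => Y n ω) m} := by
    ext ω; exact time_le_iff
  exact h ▸ measurableSet_le_count hY n m

theorem measurableSet_time_eq (hY : ∀ n, Measurable (Y n)) (n m : ℕ) :
    MeasurableSet[processFiltration Y hY m] {ω | R.time n (fun n => Y n ω) = m} :=
  (isStoppingTime_time hY n).measurableSet_eq m

theorem measurable_untopD_time (hY : ∀ n, Measurable (Y n)) (n : ℕ) :
    Measurable fun ω => (R.time n fun n => Y n ω).untopD 0 := by
  have hm : ∀ m : ℕ, MeasurableSet {ω | R.time n (fun n => Y n ω) = m} := fun m =>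
    (processFiltration Y hY).le m _ (measurableSet_time_eq hY n m)
  refine measurable_to_countable' fun m => ?_
  -- The value `0` is also the default at `⊤`, which accounts for the second part of the union.
  have h : (fun ω => (R.time n fun n => Y n ω).untopD 0) ⁻¹' {m} =
      {ω | R.time n (fun n => Y n ω) = m} ∪
        ((⋃ k : ℕ, {ω | R.time n (fun n => Y n ω) = k})ᶜ ∩ {_ω | m = 0}) := by
    ext ω
    simp only [Set.mem_preimage, Set.mem_singleton_iff, Set.mem_union, Set.mem_ofPred_eq,
      Set.mem_inter_iff, Set.mem_compl_iff, Set.mem_iUnion]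
    cases hω : R.time n (fun n => Y n ω) with
    | top => simp [eq_comm]
    | coe k =>
      have : ∃ k' : ℕ, (k : WithTop ℕ) = (k' : WithTop ℕ) := ⟨k, rfl⟩
      rw [WithTop.untopD_coe]
      exact ⟨fun h => Or.inl (congrArg _ h), fun h => h.elim WithTop.coe_inj.1
        fun h => absurd this h.1⟩
  rw [h]
  exact (hm m).union ((MeasurableSet.iUnion hm).compl.inter (MeasurableSet.const _))

theorem measurable_valueAt {E : Type*} [MeasurableSpace E] {Y : ℕ → Ω → E}
    (hY : ∀ n, Measurable (Y n)) {σ : Ω → WithTop ℕ} (hσ : Measurable fun ω => (σ ω).untopD 0) :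
    Measurable (valueAt Y σ) := by
  have h : Measurable fun x : ℕ × Ω => Y x.1 x.2 := measurable_from_prod_countable_right hY
  exact h.comp (hσ.prodMk measurable_id)

/-! ### The law of an excursion -/

variable [DiscreteMeasurableSpace G] [Countable G]

theorem ae_isAdmissible (hY : IsMarkovChain W.kernel (1, 0) Y μ) :
    ∀ᵐ ω ∂μ, IsAdmissible W fun n => Y n ω := by
  filter_upwards [hY.init, W.ae_kernel_ne_zero hY] with ω h1 h2
  exact ⟨h1, h2⟩

/-- The strong Markov property at a deterministic time at which the state is known. -/
theorem measureReal_inter_hit (hY : IsMarkovChain W.kernel (1, 0) Y μ) (D : Set Z) (t : ℕ)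
    {m : ℕ} {z : Z} {A : Set Ω} (hA : MeasurableSet[processFiltration Y hY.measurable m] A)
    (hAz : ∀ ω ∈ A, R.reset (R.state (fun n => Y n ω) m) = z) :
    μ.real (A ∩ {ω | (∀ j < t, R.state (fun n => Y n ω) (m + 1 + j) ∉ R.terminal) ∧
      R.state (fun n => Y n ω) (m + 1 + t) ∈ D}) = μ.real A * R.hitProb D t z := by
  classical
  have := hY.isProbabilityMeasure
  have hstate : ∀ (D : Set Z) (m : ℕ), MeasurableSet {ω | R.state (fun n => Y n ω) m ∈ D} :=
    fun D m => (processFiltration Y hY.measurable).le m _ (measurableSet_state hY.measurable m D)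
  have hBm : ∀ m t, MeasurableSet {ω |
      (∀ j < t, R.state (fun n => Y n ω) (m + 1 + j) ∉ R.terminal) ∧
      R.state (fun n => Y n ω) (m + 1 + t) ∈ D} := by
    intro m t
    have h : {ω | (∀ j < t, R.state (fun n => Y n ω) (m + 1 + j) ∉ R.terminal) ∧
        R.state (fun n => Y n ω) (m + 1 + t) ∈ D} =
        (⋂ j : ℕ, ⋂ _ : j < t, {ω | R.state (fun n => Y n ω) (m + 1 + j) ∈ R.terminal}ᶜ) ∩
        {ω | R.state (fun n => Y n ω) (m + 1 + t) ∈ D} := by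
      ext ω; simp
    rw [h]
    exact (MeasurableSet.iInter fun j => MeasurableSet.iInter fun _ => (hstate _ _).compl).inter
      (hstate _ _)
  have hcol : ∀ v m, MeasurableSet {ω | (Y m ω).2 = v} := fun v m =>
    (measurable_snd.comp (hY.measurable m)) (measurableSet_singleton v)
  induction t generalizing m z A with
  | zero =>
    have hAm := (processFiltration Y hY.measurable).le m _ hA
    have hcolz : ∀ᵐ ω ∂μ, ω ∈ A → (Y m ω).2 = R.color z := by
      filter_upwards [ae_isAdmissible hY] with ω hω h
      rw [← hAz ω h, color_reset, (hω.state_mem_and_color m).2]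
    rw [measureReal_eq_sum_inter (hAm.inter (hBm m 0)) (hcol · (m + 1)), hitProb, Finset.mul_sum]
    refine Finset.sum_congr rfl fun v _ => ?_
    rw [← mul_assoc, ← W.measureReal_inter_color_eq hY hA hcolz v]
    have key : ∀ ω ∈ A, (Y (m + 1) ω).2 = v →
        R.state (fun n => Y n ω) (m + 1) = R.next z v := fun ω h hv => by
      rw [state, hAz ω h, hv]
    split_ifs with hD
    · rw [mul_one]
      congr 1; ext ω
      simp only [Set.mem_inter_iff, Set.mem_ofPred_eq, not_lt_zero, false_imp_iff, forall_const,
        true_and, add_zero]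
      exact ⟨fun h => ⟨h.1.1, h.2⟩, fun h => ⟨⟨h.1, key ω h.1 h.2 ▸ hD⟩, h.2⟩⟩
    · rw [mul_zero, ← measureReal_empty (μ := μ)]
      congr 1; ext ω
      simp only [Set.mem_inter_iff, Set.mem_ofPred_eq, Set.mem_empty_iff_false, iff_false, add_zero]
      rintro ⟨⟨h1, h2⟩, h3⟩
      exact hD (key ω h1 h3 ▸ h2.2)
  | succ t ih =>
    have hAm := (processFiltration Y hY.measurable).le m _ hA
    have hcolz : ∀ᵐ ω ∂μ, ω ∈ A → (Y m ω).2 = R.color z := by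
      filter_upwards [ae_isAdmissible hY] with ω hω h
      rw [← hAz ω h, color_reset, (hω.state_mem_and_color m).2]
    rw [measureReal_eq_sum_inter (hAm.inter (hBm m (t + 1))) (hcol · (m + 1)), hitProb,
      Finset.mul_sum]
    refine Finset.sum_congr rfl fun v _ => ?_
    rw [← mul_assoc, ← W.measureReal_inter_color_eq hY hA hcolz v]
    have key : ∀ ω ∈ A, (Y (m + 1) ω).2 = v →
        R.state (fun n => Y n ω) (m + 1) = R.next z v := fun ω h hv => by
      rw [state, hAz ω h, hv]
    split_ifs with hT
    · rw [mul_zero, ← measureReal_empty (μ := μ)]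
      congr 1; ext ω
      simp only [Set.mem_inter_iff, Set.mem_ofPred_eq, Set.mem_empty_iff_false, iff_false]
      rintro ⟨⟨h1, h2⟩, h3⟩
      exact h2.1 0 (by omega) (key ω h1 h3 ▸ hT)
    · rw [← ih (m := m + 1) (A := A ∩ {ω | (Y (m + 1) ω).2 = v})]
      · congr 1; ext ω
        simp only [Set.mem_inter_iff, Set.mem_ofPred_eq]
        rw [show m + 1 + 1 + t = m + 1 + (t + 1) by ring]
        constructor
        · rintro ⟨⟨h1, h2, h3⟩, h4⟩
          exact ⟨⟨h1, h4⟩, fun j hj => by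
            rw [show m + 1 + 1 + j = m + 1 + (j + 1) by ring]; exact h2 _ (by omega), h3⟩
        · rintro ⟨⟨h1, h4⟩, h2, h3⟩
          refine ⟨⟨h1, fun j hj => ?_, h3⟩, h4⟩
          cases j with
          | zero => rw [add_zero, key ω h1 h4]; exact hT
          | succ j =>
            rw [show m + 1 + (j + 1) = m + 1 + 1 + j by ring]; exact h2 _ (by omega)
      · exact ((processFiltration Y hY.measurable).mono (Nat.le_succ m) _ hA).inter
          (measurableSet_processFiltration_color hY.measurable le_rfl v)
      · rintro ω ⟨h1, h2⟩
        rw [key ω h1 h2, reset_of_notMem hT]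

end RenewalTracker

/-! ### Joint law of the excursions and the renewal structure -/

namespace RenewalTracker

section Excursion

variable {G : Type*} [Group G] {r : ℕ} [NeZero r] {W : ColoredWalk G r} {Z : Type*}
  {R : RenewalTracker W Z} {Ω : Type*} {Y : ℕ → Ω → G × Fin r}

/-- The duration and the displacement of the `n`-th excursion. -/
noncomputable def excursion (R : RenewalTracker W Z) (Y : ℕ → Ω → G × Fin r) (n : ℕ) (ω : Ω) :
    ℕ × G :=
  ((R.time (n + 1) fun n => Y n ω).untopD 0 - (R.time n fun n => Y n ω).untopD 0,
    (valueAt Y (fun ω => R.time n fun n => Y n ω) ω).1⁻¹ *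
      (valueAt Y (fun ω => R.time (n + 1) fun n => Y n ω) ω).1)

/-- The terminal states with displacement `g`. -/
def terminalAt (R : RenewalTracker W Z) (g : G) : Set Z := {z ∈ R.terminal | R.disp z = g}

/-- The law of the duration and of the displacement of an excursion. -/
noncomputable def excursionLaw (R : RenewalTracker W Z) : ℕ × G → ℝ
  | (0, _) => 0
  | (t + 1, g) => R.hitProb (R.terminalAt g) t R.root

/-- Prescribing the durations fixes every renewal time. An event about excursions thus becomes one
at deterministic times, to which the Markov property applies. -/
theorem excursion_eq_iff {ω : Ω} (hω : ∀ n, R.time n (fun n => Y n ω) ≠ ⊤) (n : ℕ)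
    (x : ℕ → ℕ × G) :
    (∀ i < n, R.excursion Y i ω = x i) ↔
      (∀ i ≤ n, R.time i (fun n => Y n ω) = ((∑ j ∈ Finset.range i, (x j).1 : ℕ) : WithTop ℕ)) ∧
      ∀ i < n, (Y (∑ j ∈ Finset.range i, (x j).1) ω).1⁻¹ *
        (Y (∑ j ∈ Finset.range (i + 1), (x j).1) ω).1 = (x i).2 := by
  have hval : ∀ i m, R.time i (fun n => Y n ω) = ((m : ℕ) : WithTop ℕ) →
      (R.time i fun n => Y n ω).untopD 0 = m := fun i m h => by
    rw [h]; exact WithTop.untopD_coe _ _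
  constructor
  · intro h
    have ht : ∀ i ≤ n, R.time i (fun n => Y n ω) =
        ((∑ j ∈ Finset.range i, (x j).1 : ℕ) : WithTop ℕ) := by
      intro i hi
      induction i with
      | zero => simp
      | succ i ih =>
        have h1 := ih (by omega)
        obtain ⟨k, hk⟩ := WithTop.ne_top_iff_exists.1 (hω (i + 1))
        have h2 := time_lt_time_succ (hω i)
        rw [h1, ← hk] at h2
        have h2' := WithTop.coe_lt_coe.1 h2
        have h3 := congrArg Prod.fst (h i (by omega))
        simp only [excursion, hval _ _ h1, hval _ _ hk.symm] at h3
        have h4 : k = ∑ j ∈ Finset.range (i + 1), (x j).1 := by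
          rw [Finset.sum_range_succ]
          simp only [Nat.cast_id] at h2'
          omega
        rw [← hk, h4]
        rfl
    refine ⟨ht, fun i hi => ?_⟩
    have h3 := congrArg Prod.snd (h i (by omega))
    simp only [excursion, valueAt, hval _ _ (ht i (by omega)), hval _ _ (ht (i + 1) (by omega))]
      at h3
    exact h3
  · rintro ⟨h1, h2⟩ i hi
    have e1 := hval _ _ (h1 i (by omega))
    have e2 := hval _ _ (h1 (i + 1) (by omega))
    refine Prod.ext ?_ ?_
    · simp only [excursion, e1, e2, Finset.sum_range_succ]
      omega
    · simp only [excursion, valueAt, e1, e2]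
      exact h2 i hi

end Excursion

section Renewal

variable {G : Type*} [Group G] [MeasurableSpace G] [DiscreteMeasurableSpace G] [Countable G]
  {r : ℕ} [NeZero r] {W : ColoredWalk G r} {Z : Type*}
  {R : RenewalTracker W Z} {Ω : Type*} [MeasurableSpace Ω] {μ : Measure Ω}
  {Y : ℕ → Ω → G × Fin r}

theorem ae_time_ne_top (hY : IsMarkovChain W.kernel (1, 0) Y μ)
    (h0 : Filter.Tendsto (fun t => R.hitProb R.terminalᶜ t R.root) Filter.atTop (nhds 0)) :
    ∀ᵐ ω ∂μ, ∀ n, R.time n (fun n => Y n ω) ≠ ⊤ := by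
  have := hY.isProbabilityMeasure
  have key : ∀ n m : ℕ, ∀ᵐ ω ∂μ, R.time n (fun n => Y n ω) = m →
      R.time (n + 1) (fun n => Y n ω) ≠ ⊤ := by
    intro n m
    -- A missing next renewal means survival for `t + 1` steps after `m`, for every `t`; letting `t`
    -- tend to infinity makes the bound vanish.
    have hb : ∀ t, μ.real ({ω | R.time n (fun n => Y n ω) = m} ∩
        {ω | R.time (n + 1) (fun n => Y n ω) = ⊤}) ≤
        μ.real {ω | R.time n (fun n => Y n ω) = m} * R.hitProb R.terminalᶜ t R.root := by
      intro t
      rw [← measureReal_inter_hit hY R.terminalᶜ t (measurableSet_time_eq hY.measurable n m)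
        fun ω hω => reset_state_of_time_eq hω]
      refine measureReal_mono ?_
      rintro ω ⟨h1, h2⟩
      refine ⟨h1, ?_⟩
      have h3 := (lt_time_succ_iff h1 (t + 1)).1 (by
        rw [show R.time (n + 1) (fun n => Y n ω) = ⊤ from h2]; exact WithTop.coe_lt_top _)
      exact ⟨fun j hj => h3 j (by omega), h3 t (by omega)⟩
    have hle := ge_of_tendsto' (h0.const_mul (μ.real {ω | R.time n (fun n => Y n ω) = m})) hb
    rw [mul_zero] at hle
    have hz := (measureReal_eq_zero_iff).1 (le_antisymm hle measureReal_nonneg)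
    filter_upwards [measure_eq_zero_iff_ae_notMem.1 hz] with ω hω h1 h2
    exact hω ⟨h1, h2⟩
  filter_upwards [ae_all_iff.2 fun n => ae_all_iff.2 (key n)] with ω hω n
  induction n with
  | zero => simp
  | succ n ih =>
    obtain ⟨m, hm⟩ := WithTop.ne_top_iff_exists.1 ih
    exact hω n m hm.symm

theorem measurable_excursion (hY : ∀ n, Measurable (Y n)) (n : ℕ) :
    Measurable (R.excursion Y n) := by
  have hT := measurable_untopD_time (R := R) hY
  have hV : ∀ n, Measurable fun ω => (valueAt Y (fun ω => R.time n fun n => Y n ω) ω).1 :=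
    fun n => measurable_fst.comp (measurable_valueAt hY (hT n))
  have h2 : Measurable fun x : G × G => x.1⁻¹ * x.2 := Measurable.of_discrete
  have h1 : Measurable fun x : ℕ × ℕ => x.1 - x.2 := Measurable.of_discrete
  exact (h1.comp ((hT (n + 1)).prodMk (hT n))).prodMk (h2.comp ((hV n).prodMk (hV (n + 1))))

/-- The event that the first `n` excursions are as prescribed belongs, up to a null set, to the past
at the deterministic time `M n`. On it the automaton is back at the root, so `measureReal_inter_hit`
contributes exactly one factor for the next excursion. -/
theorem measureReal_excursion_eq (hY : IsMarkovChain W.kernel (1, 0) Y μ)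
    (h0 : Filter.Tendsto (fun t => R.hitProb R.terminalᶜ t R.root) Filter.atTop (nhds 0))
    (n : ℕ) (x : ℕ → ℕ × G) :
    μ.real {ω | ∀ i < n, R.excursion Y i ω = x i} =
      ∏ i ∈ Finset.range n, R.excursionLaw (x i) := by
  have := hY.isProbabilityMeasure
  set M : ℕ → ℕ := fun i => ∑ j ∈ Finset.range i, (x j).1 with hM
  have hMmono : Monotone M := fun i j hij =>
    Finset.sum_le_sum_of_subset (Finset.range_mono hij)
  set A : ℕ → Set Ω := fun n => {ω | (∀ i ≤ n, R.time i (fun n => Y n ω) = (M i : WithTop ℕ)) ∧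
    ∀ i < n, (Y (M i) ω).1⁻¹ * (Y (M (i + 1)) ω).1 = (x i).2} with hA
  have hfin := ae_time_ne_top hY h0
  have hAe : {ω | ∀ i < n, R.excursion Y i ω = x i} =ᵐ[μ] A n := by
    filter_upwards [hfin] with ω hω
    exact propext (excursion_eq_iff hω n x)
  rw [measureReal_congr hAe]
  clear hAe
  have hAF : ∀ n, MeasurableSet[processFiltration Y hY.measurable (M n)] (A n) := by
    intro n
    have e : A n = (⋂ i : ℕ, ⋂ _ : i ≤ n, {ω | R.time i (fun n => Y n ω) = (M i : WithTop ℕ)}) ∩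
        ⋂ i : ℕ, ⋂ _ : i < n, ⋃ a : G, (Y (M i) ⁻¹' {y | y.1 = a}) ∩
          (Y (M (i + 1)) ⁻¹' {y | a⁻¹ * y.1 = (x i).2}) := by
      ext ω; simp [hA]
    rw [e]
    refine MeasurableSet.inter ?_ ?_
    · exact MeasurableSet.iInter fun i => MeasurableSet.iInter fun hi =>
        (processFiltration Y hY.measurable).mono (hMmono hi) _
          (measurableSet_time_eq hY.measurable i (M i))
    · exact MeasurableSet.iInter fun i => MeasurableSet.iInter fun hi =>
        MeasurableSet.iUnion fun a =>
          (measurableSet_processFiltration_preimage hY.measurable (hMmono hi.le)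
            (MeasurableSet.of_discrete)).inter
          (measurableSet_processFiltration_preimage hY.measurable (hMmono hi)
            (MeasurableSet.of_discrete))
  induction n with
  | zero =>
    have : A 0 = Set.univ := by
      ext ω; simp [hA, hM]
    simp [this]
  | succ n ih =>
    rw [Finset.prod_range_succ, ← ih]
    have hsucc : ∀ ω, ω ∈ A (n + 1) ↔ ω ∈ A n ∧
        R.time (n + 1) (fun n => Y n ω) = (M (n + 1) : WithTop ℕ) ∧
        (Y (M n) ω).1⁻¹ * (Y (M (n + 1)) ω).1 = (x n).2 := by
      intro ω
      simp only [hA, Set.mem_ofPred_eq, Nat.forall_lt_succ_right, Nat.le_succ_iff, or_imp,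
        forall_and, forall_eq]
      tauto
    have hMs : M (n + 1) = M n + (x n).1 := Finset.sum_range_succ _ _
    rcases hx : x n with ⟨t, g⟩
    cases t with
    | zero =>
      have : A (n + 1) = ∅ := by
        ext ω
        simp only [hsucc, Set.mem_empty_iff_false, iff_false]
        rintro ⟨h1, h2, -⟩
        have h3 := h1.1 n le_rfl
        have h4 := time_lt_time_succ (R := R) (y := fun n => Y n ω) (n := n)
          (by rw [h3]; exact WithTop.coe_ne_top)
        rw [h2, h3, hMs, hx, add_zero] at h4
        exact lt_irrefl _ h4
      simp [this, excursionLaw]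
    | succ t =>
      rw [excursionLaw, ← measureReal_inter_hit hY (R.terminalAt g) t (hAF n)
        fun ω hω => reset_state_of_time_eq (hω.1 n le_rfl)]
      refine measureReal_congr ?_
      filter_upwards [ae_isAdmissible hY] with ω hω
      refine propext ((hsucc ω).trans (and_congr_right fun h1 => ?_))
      have h3 := h1.1 n le_rfl
      have e : M (n + 1) = M n + 1 + t := by rw [hMs, hx]; ring
      rw [e, time_succ_eq_iff h3, and_assoc]
      refine and_congr_right fun h4 => ?_
      have h5 := hω.disp_state (reset_state_of_time_eq h3) t h4
      simp only [hx, ← h5]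
      rfl

/-- If the renewals have finite mean duration and displacement of law `p`, then the walk observed
at the renewals is the random walk with step distribution `p`. -/
theorem isRenewalProcess_and_isMarkovChain (hY : IsMarkovChain W.kernel (1, 0) Y μ)
    {p : G → ℝ} (hsum : Summable fun t => R.hitProb R.terminalᶜ t R.root)
    (hp : ∀ g, HasSum (fun t => R.hitProb (R.terminalAt g) t R.root) (p g)) :
    IsRenewalProcess (fun n ω => R.time n fun n => Y n ω) μ ∧
    (∀ᵐ ω ∂μ, ∀ n, (valueAt Y (fun ω => R.time n fun n => Y n ω) ω).2 = 0) ∧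
    IsMarkovChain (walkKernel p) 1
      (fun n ω => (valueAt Y (fun ω => R.time n fun n => Y n ω) ω).1) μ := by
  classical
  have := hY.isProbabilityMeasure
  have h0 := hsum.tendsto_atTop_zero
  have hfin := ae_time_ne_top hY h0
  have hXm := measurable_excursion (R := R) hY.measurable
  obtain ⟨hind, hid⟩ := iIndepFun_and_identDistrib_of_measureReal_eq_prod hXm
    (measureReal_excursion_eq hY h0)
  have hmono : ∀ ω, (∀ n, R.time n (fun n => Y n ω) ≠ ⊤) →
      StrictMono fun n => R.time n fun n => Y n ω := fun ω hω =>
    strictMono_nat_of_lt_succ fun n => time_lt_time_succ (hω n)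
  have hinc : ∀ n, (fun ω => ((R.excursion Y n ω).1 : ℝ)) =ᵐ[μ]
      timeIncrement (fun n ω => R.time n fun n => Y n ω) n := by
    intro n
    filter_upwards [hfin] with ω hω
    have h1 := hmono ω hω (Nat.lt_succ_self n)
    obtain ⟨a, ha⟩ := WithTop.ne_top_iff_exists.1 (hω n)
    obtain ⟨b, hb⟩ := WithTop.ne_top_iff_exists.1 (hω (n + 1))
    simp only [← ha, ← hb, Nat.succ_eq_add_one] at h1
    have h2 := WithTop.coe_lt_coe.1 h1
    simp only [excursion, timeIncrement, ← ha, ← hb, WithTop.untopD_coe]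
    push_cast [h2.le]
    rfl
  have hcast : Measurable fun x : ℕ × G => ((x.1 : ℕ) : ℝ) := Measurable.of_discrete
  have hlaw1 : ∀ x, μ.real {ω | R.excursion Y 0 ω = x} = R.excursionLaw x := fun x => by
    simpa using measureReal_excursion_eq hY h0 1 fun _ => x
  refine ⟨⟨fun ω => time_zero, hfin, hfin.mono hmono, ?_, fun n => ?_, ?_⟩, ?_, ?_⟩
  · exact (hind.comp (fun _ x => ((x.1 : ℕ) : ℝ)) fun _ => hcast).congr hinc
  · have h := (hid n).comp hcast
    exact ((IdentDistrib.of_ae_eq (hcast.comp (hXm n)).aemeasurable (hinc n)).symm.trans h).trans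
      (IdentDistrib.of_ae_eq (hcast.comp (hXm 0)).aemeasurable (hinc 0))
  · refine Integrable.congr ?_ (hinc 0)
    refine ⟨(hcast.comp (hXm 0)).aestronglyMeasurable, ?_⟩
    have hlt : ∀ t : ℕ, MeasurableSet {ω | t < (R.excursion Y 0 ω).1} := fun t =>
      (measurable_fst.comp (hXm 0)) (MeasurableSet.of_discrete (s := {k | t < k}))
    -- A duration exceeding `t + 1` forces the states `1, …, t + 1` to be nonterminal. This is the
    -- event measured by `hitProb` with index `t`.
    have htail : ∀ t : ℕ, μ {ω | t + 1 < (R.excursion Y 0 ω).1} ≤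
        ENNReal.ofReal (R.hitProb R.terminalᶜ t R.root) := by
      intro t
      have h := measureReal_inter_hit hY R.terminalᶜ t (R := R) (m := 0) (A := Set.univ)
        MeasurableSet.univ fun ω _ => reset_root
      rw [probReal_univ, one_mul] at h
      rw [← h, measureReal_def, ENNReal.ofReal_toReal (measure_ne_top _ _)]
      refine measure_mono_ae ?_
      filter_upwards [hfin] with ω hω h1
      refine ⟨trivial, ?_⟩
      obtain ⟨b, hb⟩ := WithTop.ne_top_iff_exists.1 (hω 1)
      have h1' : t + 1 < (R.excursion Y 0 ω).1 := h1
      simp only [excursion, time_zero, zero_add, ← hb, WithTop.untopD_coe] at h1'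
      have h2 : t + 1 < b := lt_of_lt_of_le h1' (Nat.sub_le _ _)
      have h3 := (lt_time_succ_iff (R := R) (y := fun n => Y n ω) (n := 0) (m := 0)
        (by simp) (t + 1)).1 (by
          rw [zero_add, zero_add, ← hb]; exact WithTop.coe_lt_coe.2 h2)
      exact ⟨fun j hj => h3 j (by omega), h3 t (by omega)⟩
    -- Tail-sum formula: a natural number is the sum over `t` of the indicators that it exceeds `t`.
    have hcard : ∀ ω, ‖((R.excursion Y 0 ω).1 : ℝ)‖ₑ =
        ∑' t : ℕ, {ω | t < (R.excursion Y 0 ω).1}.indicator (fun _ => (1 : ENNReal)) ω := by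
      intro ω
      rw [tsum_eq_sum (s := Finset.range (R.excursion Y 0 ω).1)]
      · have h1 : ∀ t ∈ Finset.range (R.excursion Y 0 ω).1,
            {ω | t < (R.excursion Y 0 ω).1}.indicator (fun _ => (1 : ENNReal)) ω = 1 :=
          fun t ht => Set.indicator_of_mem (s := {ω | t < (R.excursion Y 0 ω).1})
            (Finset.mem_range.1 ht) _
        rw [Finset.sum_congr rfl h1]
        simp
      · intro t ht
        exact Set.indicator_of_notMem (by simpa using ht) _
    have hlint : ∫⁻ ω, ‖((R.excursion Y 0 ω).1 : ℝ)‖ₑ ∂μ < ⊤ := by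
      simp only [hcard]
      rw [lintegral_tsum fun t => (measurable_const.indicator (hlt t)).aemeasurable]
      simp only [lintegral_indicator_const (hlt _), one_mul]
      -- The term `t = 0` is split off because `htail` only bounds the tails from `1` on.
      rw [tsum_eq_zero_add' ENNReal.summable]
      refine ENNReal.add_lt_top.2 ⟨measure_lt_top _ _, (ENNReal.tsum_le_tsum htail).trans_lt ?_⟩
      rw [← ENNReal.ofReal_tsum_of_nonneg (fun t => hitProb_nonneg _ t _) hsum]
      exact ENNReal.ofReal_lt_top
    exact hlint
  · filter_upwards [ae_isAdmissible hY, hfin] with ω hω hω' n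
    obtain ⟨m, hm⟩ := WithTop.ne_top_iff_exists.1 (hω' n)
    have h1 := reset_state_of_time_eq hm.symm
    simp only [valueAt, ← hm, WithTop.untopD_coe]
    have h2 := (hω.state_mem_and_color (R := R) m).2
    rw [← color_reset, h1, R.color_root] at h2
    exact h2.symm
  · have hstart : ∀ᵐ ω ∂μ, (valueAt Y (fun ω => R.time 0 fun n => Y n ω) ω).1 = 1 := by
      filter_upwards [hY.init] with ω hω
      simp [valueAt, hω]
    have hstep : ∀ g, μ.real (R.excursion Y 0 ⁻¹' {x | x.2 = g}) = p g := by
      intro g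
      have hU : R.excursion Y 0 ⁻¹' {x | x.2 = g} = ⋃ t : ℕ, {ω | R.excursion Y 0 ω = (t, g)} := by
        ext ω; simp [Prod.ext_iff]
      have hlaw : HasSum (fun t : ℕ => R.excursionLaw (t, g)) (p g) := by
        rw [← hasSum_nat_add_iff' 1]
        simpa [excursionLaw] using hp g
      rw [hU, measureReal_def, measure_iUnion, ENNReal.tsum_toReal_eq fun t => measure_ne_top _ _]
      · simp only [← measureReal_def, hlaw1]
        exact hlaw.tsum_eq
      · intro t t' htt'
        refine Set.disjoint_left.2 fun ω h h' => htt' ?_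
        have h1 : R.excursion Y 0 ω = (t, g) := h
        have h2 : R.excursion Y 0 ω = (t', g) := h'
        exact congrArg Prod.fst (h1.symm.trans h2)
      · exact fun t => hXm 0 (measurableSet_singleton _)
    -- Given the start, the path at the renewals and the sequence of displacements determine each
    -- other, so its probability is a product. The indicator covers test paths not starting at the
    -- identity.
    have hpath : ∀ (n : ℕ) (x : ℕ → G), μ.real {ω | ∀ i ≤ n,
        (valueAt Y (fun ω => R.time i fun n => Y n ω) ω).1 = x i} =
        (if x 0 = 1 then 1 else 0) * ∏ i ∈ Finset.range n, p ((x i)⁻¹ * x (i + 1)) := by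
      intro n x
      split_ifs with hx
      · rw [one_mul]
        have hprod := congrArg ENNReal.toReal (hind.measure_inter_preimage_eq_mul
          (Finset.range n) (sets := fun i => {y | y.2 = (x i)⁻¹ * x (i + 1)})
          fun i _ => MeasurableSet.of_discrete)
        rw [ENNReal.toReal_prod] at hprod
        simp only [(hid _).measure_mem_eq (MeasurableSet.of_discrete), ← measureReal_def,
          hstep] at hprod
        rw [← hprod]
        refine measureReal_congr ?_
        filter_upwards [hstart] with ω hω
        refine propext (Iff.trans ?_ Set.mem_iInter₂.symm)
        simp only [Finset.mem_range]
        constructor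
        · intro h i hi
          have h1 := h i (by omega)
          have h2 := h (i + 1) (by omega)
          change (R.excursion Y i ω).2 = _
          rw [excursion, h1, h2]
        · intro h i hi
          induction i with
          | zero => rw [hω, hx]
          | succ i ih =>
            have h1 : (R.excursion Y i ω).2 = (x i)⁻¹ * x (i + 1) := h i (by omega)
            rw [excursion, ih (by omega)] at h1
            exact mul_left_cancel h1
      · rw [zero_mul, measureReal_eq_zero_iff, measure_eq_zero_iff_ae_notMem]
        filter_upwards [hstart] with ω hω h
        exact hx ((h 0 (Nat.zero_le n)).symm.trans hω)
    refine ⟨this, fun n => measurable_fst.comp (measurable_valueAt hY.measurable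
      (measurable_untopD_time hY.measurable n)), hstart, fun n x => ?_⟩
    rw [hpath, hpath, Finset.prod_range_succ, mul_assoc, walkKernel]

end Renewal

/-- A colored walk with an automaton whose renewals have a Lyapunov function `f` and harmonic
functions `H g` linearizes the random walk with step distribution `p`. -/
theorem linearizes {G : Type u} [Group G] [MeasurableSpace G] [DiscreteMeasurableSpace G]
    [Countable G] {r : ℕ} [NeZero r] {W : ColoredWalk G r} {Z : Type*} (R : RenewalTracker W Z)
    {p : G → ℝ} {f : Z → ℝ} {H : G → Z → ℝ}
    (hf : ∀ z ∈ R.live ∪ R.terminal, 0 ≤ f z)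
    (hdrift : ∀ z ∈ R.live, ∑ v, W.colorMatrix (R.color z) v * f (R.next z v) ≤ f z - 1)
    (hH0 : ∀ g, ∀ z ∈ R.live, 0 ≤ H g z) (hH1 : ∀ g, ∀ z ∈ R.live, H g z ≤ 1)
    (hHeq : ∀ g, ∀ z ∈ R.terminal, R.disp z = g → H g z = 1)
    (hHne : ∀ g, ∀ z ∈ R.terminal, R.disp z ≠ g → H g z = 0)
    (hharm : ∀ g, ∀ z ∈ R.live, ∑ v, W.colorMatrix (R.color z) v * H g (R.next z v) = H g z)
    (hroot : ∀ g, H g R.root = p g) : W.Linearizes p := by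
  classical
  intro Ω _ μ Y hY
  refine ⟨fun n ω => R.time n fun n => Y n ω, isStoppingTime_time hY.measurable,
    isRenewalProcess_and_isMarkovChain hY (summable_hitProb_compl hf hdrift R.root_mem)
      fun g => ?_⟩
  rw [← hroot g]
  refine hasSum_hitProb (fun z hz => hz.1) (hH0 g) (hH1 g) (fun z hz => ?_) (hharm g) hf hdrift
    R.root_mem
  split_ifs with h
  · exact hHeq g z hz h.2
  · exact hHne g z hz fun h' => h ⟨hz, h'⟩

end RenewalTracker

/-- Irreducibility demands paths of positive length, even from a state to itself; hence the
transitive closure without reflexivity. -/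
theorem Matrix.isIrreducible_of_transGen {n : Type*} {A : Matrix n n ℝ} (hA : ∀ i j, 0 ≤ A i j)
    (h : ∀ i j, Relation.TransGen (fun a b => 0 < A a b) i j) : A.IsIrreducible := by
  refine ⟨hA, fun i j => ?_⟩
  let : Quiver n := A.toQuiver
  induction h i j with
  | single h => exact ⟨Quiver.Path.nil.cons ⟨h⟩, Nat.succ_pos _⟩
  | tail _ h ih =>
    obtain ⟨q, -⟩ := ih
    exact ⟨q.cons ⟨h⟩, Nat.succ_pos _⟩

/-! ### Loops of colors -/

/-- A family of loops of colors that meet only at the color `0`, together with a path in `G`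
starting at the identity above each of them. -/
structure LoopSystem (G : Type*) [Group G] (ι : Type*) (r : ℕ) [NeZero r] where
  len : ι → ℕ
  three_le_len : ∀ i, 3 ≤ len i
  col : ι → ℕ → Fin r
  col_zero : ∀ i, col i 0 = 0
  col_len : ∀ i, col i (len i) = 0
  -- Only `j` is required to be strictly inside its loop. Taking `j'` at an endpoint shows that
  -- interior colors differ from `0`.
  col_inj : ∀ {i j i' j'}, 0 < j → j < len i → j' ≤ len i' → col i j = col i' j' → i = i' ∧ j = j'
  col_surj : ∀ c, c = 0 ∨ ∃ i j, 0 < j ∧ j < len i ∧ col i j = c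
  pos : ι → ℕ → G
  pos_zero : ∀ i, pos i 0 = 1

namespace LoopSystem

variable {G : Type*} [Group G] {ι : Type*} {r : ℕ} [NeZero r] (L : LoopSystem G ι r)

/-- The arm `(i, true)` is the loop `i`, and the arm `(i, false)` is the same loop traversed
backwards. -/
def flip (b : ι × Bool) : ι × Bool := (b.1, !b.2)

/-- The `j`-th color along an arm. -/
def armCol (b : ι × Bool) (j : ℕ) : Fin r :=
  if b.2 then L.col b.1 j else L.col b.1 (L.len b.1 - j)

/-- The `j`-th position along the path above an arm. -/
def armPos (b : ι × Bool) (j : ℕ) : G :=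
  if b.2 then L.pos b.1 j else (L.pos b.1 (L.len b.1))⁻¹ * L.pos b.1 (L.len b.1 - j)

/-- The `j`-th step of the path above an arm. -/
def armStep (b : ι × Bool) (j : ℕ) : G := (L.armPos b j)⁻¹ * L.armPos b (j + 1)

@[simp] theorem flip_flip (b : ι × Bool) : flip (flip b) = b := by simp [flip]

theorem flip_ne (b : ι × Bool) : flip b ≠ b := fun h => by
  have := congrArg Prod.snd h
  simp [flip] at this

@[simp] theorem flip_fst (b : ι × Bool) : (flip b).1 = b.1 := rfl

variable {L}

theorem len_pos (i : ι) : 0 < L.len i := by have := L.three_le_len i; omega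

@[simp] theorem armCol_zero (b : ι × Bool) : L.armCol b 0 = 0 := by
  simp [armCol, L.col_zero, L.col_len]

@[simp] theorem armCol_len (b : ι × Bool) : L.armCol b (L.len b.1) = 0 := by
  simp [armCol, L.col_zero, L.col_len]

theorem armCol_flip (b : ι × Bool) {j : ℕ} (hj : j ≤ L.len b.1) :
    L.armCol (flip b) j = L.armCol b (L.len b.1 - j) := by
  rcases b with ⟨i, _ | _⟩
  · simp only [armCol, flip, Bool.not_false, if_true, Bool.false_eq_true, if_false]
    rw [Nat.sub_sub_self hj]
  · simp [armCol, flip]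

theorem armCol_eq_zero_iff (b : ι × Bool) {j : ℕ} (hj : j ≤ L.len b.1) :
    L.armCol b j = 0 ↔ j = 0 ∨ j = L.len b.1 := by
  constructor
  · intro h
    by_contra! hne
    rcases b with ⟨i, _ | _⟩
    · simp only [armCol, Bool.false_eq_true, if_false] at h hj hne
      have := (L.col_inj (i' := i) (j' := 0) (by omega) (by omega) (by omega)
        (h.trans (L.col_zero i).symm)).2
      omega
    · simp only [armCol, if_true] at h hj hne
      have := (L.col_inj (i' := i) (j' := 0) (by omega) (by omega) (by omega)
        (h.trans (L.col_zero i).symm)).2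
      omega
  · rintro (rfl | rfl) <;> simp

/-- An interior color lies on exactly one loop, hence on exactly two arms, where it is read from the
two directions. -/
theorem eq_or_eq_flip_of_armCol_eq {b b' : ι × Bool} {j j' : ℕ} (hj : 0 < j) (hj' : j < L.len b.1)
    (hj'' : j' ≤ L.len b'.1) (h : L.armCol b j = L.armCol b' j') :
    (b' = b ∧ j' = j) ∨ (b' = flip b ∧ j' = L.len b.1 - j) := by
  rcases b with ⟨i, _ | _⟩ <;> rcases b' with ⟨i', _ | _⟩ <;>
    simp only [armCol, Bool.false_eq_true, if_false, if_true] at h hj' hj'' <;>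
    obtain ⟨rfl, h⟩ := L.col_inj (by omega) (by omega) (by omega) h <;>
    simp [flip] <;> omega

/-- This makes forward and backward moves distinguishable from the colors alone. It fails for a loop
of length `2`, where both neighbors of the midpoint are `0`. -/
theorem armCol_sub_one_ne (b : ι × Bool) {j : ℕ} (hj : 0 < j) (hj' : j < L.len b.1) :
    L.armCol b (j - 1) ≠ L.armCol b (j + 1) := by
  intro h
  have h3 := L.three_le_len b.1
  rcases Nat.lt_or_ge (j + 1) (L.len b.1) with h1 | h1
  · rcases eq_or_eq_flip_of_armCol_eq (by omega) h1 (by omega) h.symm with h2 | h2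
    · omega
    · exact flip_ne b h2.1.symm
  · have e : j + 1 = L.len b.1 := by omega
    rw [e, armCol_len, armCol_eq_zero_iff b (by omega)] at h
    omega

/-- The first color after `0` reveals the arm. On a loop of length `2` the two directions would
share that color; this is the other use of the bound `3`. -/
theorem armCol_one_inj {b b' : ι × Bool} (h : L.armCol b 1 = L.armCol b' 1) : b = b' := by
  have h3 := L.three_le_len b.1
  have h3' := L.three_le_len b'.1
  rcases eq_or_eq_flip_of_armCol_eq one_pos (by omega) (by omega) h with h2 | h2
  · exact h2.1.symm
  · omega

@[simp] theorem armPos_zero (b : ι × Bool) : L.armPos b 0 = 1 := by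
  simp [armPos, L.pos_zero]

/-- The edge `j` of an arm is the edge `len - 1 - j` of the flipped arm with reversed orientation,
so its group label is inverted. -/
theorem armStep_flip (b : ι × Bool) {j : ℕ} (hj : j < L.len b.1) :
    L.armStep (flip b) (L.len b.1 - 1 - j) = (L.armStep b j)⁻¹ := by
  have e : L.len b.1 - 1 - j + 1 = L.len b.1 - j := by omega
  have e2 : L.len b.1 - (L.len b.1 - 1 - j) = j + 1 := by omega
  have e3 : L.len b.1 - (L.len b.1 - j) = j := by omega
  have e4 : L.len b.1 - (j + 1) = L.len b.1 - 1 - j := by omega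
  rcases b with ⟨i, _ | _⟩
  · simp only [armStep, armPos, flip, Bool.not_false, if_true, Bool.false_eq_true, if_false]
      at e e2 e3 e4 ⊢
    rw [e, e4]
    group
  · simp only [armStep, armPos, flip, Bool.not_true, if_true, Bool.false_eq_true, if_false]
      at e e2 e3 e4 ⊢
    rw [e, e2, e3]
    group

/-! ### The walk around the loops -/

/-- From the color `0` the arm `b` is entered with probability `enter b`; inside the loops the walk
is symmetric. -/
noncomputable def weight (enter : ι × Bool → ℝ) (e : Σ _ : ι × Bool, ℕ) : ℝ :=
  if e.2 = 0 then enter e.1 else 1 / 2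

theorem weight_nonneg {enter : ι × Bool → ℝ} (h : ∀ b, 0 ≤ enter b) (e : Σ _ : ι × Bool, ℕ) :
    0 ≤ weight enter e := by
  unfold weight; split_ifs
  exacts [h _, by norm_num]

theorem exists_arm (c : Fin r) : c = 0 ∨ ∃ b : ι × Bool, ∃ j, 0 < j ∧ j < L.len b.1 ∧
    L.armCol b j = c := by
  refine (L.col_surj c).imp_right ?_
  rintro ⟨i, j, h1, h2, h3⟩
  exact ⟨(i, true), j, h1, h2, by simpa [armCol] using h3⟩

variable [Fintype ι]

variable (L) in
/-- The oriented edges of the loops; the edge `⟨b, j⟩` goes from `armCol b j` to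
`armCol b (j + 1)`. -/
def edges : Finset (Σ _ : ι × Bool, ℕ) := Finset.univ.sigma fun b => Finset.range (L.len b.1)

theorem mem_edges {e : Σ _ : ι × Bool, ℕ} : e ∈ L.edges ↔ e.2 < L.len e.1.1 := by
  simp [edges]

variable (L) in
/-- The transition matrix of the colors. -/
noncomputable def matrix (enter : ι × Bool → ℝ) : Matrix (Fin r) (Fin r) ℝ :=
  ∑ e ∈ L.edges, Matrix.single (L.armCol e.1 e.2) (L.armCol e.1 (e.2 + 1)) (weight enter e)

theorem sum_matrix_mul (enter : ι × Bool → ℝ) (u : Fin r) (φ : Fin r → ℝ) :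
    ∑ v, L.matrix enter u v * φ v = ∑ e ∈ L.edges,
      if L.armCol e.1 e.2 = u then weight enter e * φ (L.armCol e.1 (e.2 + 1)) else 0 := by
  simp only [matrix, Matrix.sum_apply, Finset.sum_mul, Matrix.single_apply]
  rw [Finset.sum_comm]
  refine Finset.sum_congr rfl fun e _ => ?_
  by_cases h : L.armCol e.1 e.2 = u <;> simp [h]

theorem sum_matrix_zero_mul (enter : ι × Bool → ℝ) (φ : Fin r → ℝ) :
    ∑ v, L.matrix enter 0 v * φ v = ∑ b, enter b * φ (L.armCol b 1) := by
  rw [sum_matrix_mul, edges, Finset.sum_sigma]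
  refine Finset.sum_congr rfl fun b _ => ?_
  rw [Finset.sum_eq_single 0]
  · simp [weight]
  · intro j hj hj0
    have hj := Finset.mem_range.1 hj
    rw [if_neg]
    rw [armCol_eq_zero_iff _ hj.le]
    omega
  · intro h
    exact absurd (Finset.mem_range.2 (len_pos b.1)) h

/-- Exactly two oriented edges leave an interior color: the next one on the arm `b`, and the one at
index `len - j` on the flipped arm, which leads back to index `j - 1` of `b`. -/
theorem sum_matrix_armCol_mul (enter : ι × Bool → ℝ) (φ : Fin r → ℝ) (b : ι × Bool) {j : ℕ}
    (hj : 0 < j) (hj' : j < L.len b.1) :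
    ∑ v, L.matrix enter (L.armCol b j) v * φ v =
      1 / 2 * φ (L.armCol b (j + 1)) + 1 / 2 * φ (L.armCol b (j - 1)) := by
  rw [sum_matrix_mul, Finset.sum_eq_add_of_mem (⟨b, j⟩ : Σ _ : ι × Bool, ℕ)
    ⟨flip b, L.len b.1 - j⟩ (mem_edges.2 hj') (mem_edges.2 (by simp; omega))]
  · have e1 : L.armCol (flip b) (L.len b.1 - j) = L.armCol b j := by
      rw [armCol_flip _ (by omega), Nat.sub_sub_self hj'.le]
    have e2 : L.armCol (flip b) (L.len b.1 - j + 1) = L.armCol b (j - 1) := by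
      rw [armCol_flip _ (by omega)]; congr 1; omega
    simp only [if_true, e1, e2, weight]
    rw [if_neg hj.ne', if_neg (by omega)]
  · intro h
    exact flip_ne b (congrArg Sigma.fst h).symm
  · rintro ⟨b', j'⟩ he ⟨h1, h2⟩
    rw [if_neg]
    intro h
    rcases eq_or_eq_flip_of_armCol_eq hj hj' (mem_edges.1 he).le h.symm with
      ⟨rfl, rfl⟩ | ⟨rfl, rfl⟩
    · exact h1 rfl
    · exact h2 rfl

theorem sum_matrix {enter : ι × Bool → ℝ} (h1 : ∑ b, enter b = 1) (u : Fin r) :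
    ∑ v, L.matrix enter u v = 1 := by
  rcases exists_arm (L := L) u with rfl | ⟨b, j, hj, hj', rfl⟩
  · simpa [h1] using sum_matrix_zero_mul (L := L) enter fun _ => 1
  · have := sum_matrix_armCol_mul (L := L) enter (fun _ => 1) b hj hj'
    norm_num at this
    exact this

theorem matrix_nonneg {enter : ι × Bool → ℝ} (h0 : ∀ b, 0 ≤ enter b) (u v : Fin r) :
    0 ≤ L.matrix enter u v := by
  rw [matrix, Matrix.sum_apply]
  refine Finset.sum_nonneg fun e _ => ?_
  rw [Matrix.single_apply]
  split_ifs
  exacts [weight_nonneg h0 e, le_rfl]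

open Classical in
variable (L) in
/-- The matrices of the walk around the loops. -/
noncomputable def walkMatrix (enter : ι × Bool → ℝ) (h : G) : Matrix (Fin r) (Fin r) ℝ :=
  ∑ e ∈ L.edges, if h = L.armStep e.1 e.2 then
    Matrix.single (L.armCol e.1 e.2) (L.armCol e.1 (e.2 + 1)) (weight enter e) else 0

theorem hasSum_walkMatrix (enter : ι × Bool → ℝ) :
    HasSum (L.walkMatrix enter) (L.matrix enter) := by
  classical
  exact hasSum_sum fun e _ => hasSum_ite_eq (L.armStep e.1 e.2)
    (Matrix.single (L.armCol e.1 e.2) (L.armCol e.1 (e.2 + 1)) (weight enter e))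

open Classical in
theorem walkMatrix_apply (enter : ι × Bool → ℝ) (h : G) (u v : Fin r) :
    L.walkMatrix enter h u v = ∑ e ∈ L.edges, if h = L.armStep e.1 e.2 ∧ L.armCol e.1 e.2 = u ∧
      L.armCol e.1 (e.2 + 1) = v then weight enter e else 0 := by
  rw [walkMatrix, Matrix.sum_apply]
  refine Finset.sum_congr rfl fun e _ => ?_
  by_cases h1 : h = L.armStep e.1 e.2 <;> simp [h1, Matrix.single_apply]

theorem walkMatrix_nonneg {enter : ι × Bool → ℝ} (h0 : ∀ b, 0 ≤ enter b) (h : G) (u v : Fin r) :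
    0 ≤ L.walkMatrix enter h u v := by
  rw [walkMatrix_apply]
  refine Finset.sum_nonneg fun e _ => ?_
  split_ifs
  exacts [weight_nonneg h0 e, le_rfl]

variable (L) in
/-- The walk around the loops: from the color `0` it enters the arm `b` with probability `enter b`,
and inside the loops it makes a symmetric nearest neighbor walk. -/
noncomputable def walk (enter : ι × Bool → ℝ) (h0 : ∀ b, 0 ≤ enter b) (h1 : ∑ b, enter b = 1) :
    ColoredWalk G r where
  p := L.walkMatrix enter
  nonneg := walkMatrix_nonneg h0
  summable := (hasSum_walkMatrix enter).summable
  stochastic := by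
    rw [(hasSum_walkMatrix enter).tsum_eq]
    refine ⟨matrix_nonneg h0, funext fun u => ?_⟩
    simpa [Matrix.mulVec, dotProduct] using sum_matrix h1 u

/-! ### Support and irreducibility of the walk around the loops -/

section Walk

variable {enter : ι × Bool → ℝ} {h0 : ∀ b, 0 ≤ enter b} {h1 : ∑ b, enter b = 1}

theorem colorMatrix_walk : (L.walk enter h0 h1).colorMatrix = L.matrix enter :=
  (hasSum_walkMatrix enter).tsum_eq

theorem exists_edge_of_walk_ne_zero {h : G} {u v : Fin r} (hne : (L.walk enter h0 h1).p h u v ≠ 0) :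
    ∃ b j, j < L.len b.1 ∧ L.armStep b j = h ∧ L.armCol b j = u ∧ L.armCol b (j + 1) = v := by
  classical
  change L.walkMatrix enter h u v ≠ 0 at hne
  rw [walkMatrix_apply] at hne
  obtain ⟨e, he, hne⟩ := Finset.exists_ne_zero_of_sum_ne_zero hne
  have hc := (ite_ne_right_iff.1 hne).1
  exact ⟨e.1, e.2, mem_edges.1 he, hc.1.symm, hc.2⟩

theorem walk_pos {b : ι × Bool} {j : ℕ} (hj : j < L.len b.1) (hb : 0 < enter b) :
    0 < (L.walk enter h0 h1).p (L.armStep b j) (L.armCol b j) (L.armCol b (j + 1)) := by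
  classical
  change 0 < L.walkMatrix enter _ _ _
  rw [walkMatrix_apply]
  refine Finset.sum_pos' (fun e _ => ?_) ⟨⟨b, j⟩, mem_edges.2 hj, ?_⟩
  · split_ifs
    exacts [weight_nonneg h0 e, le_rfl]
  · rw [if_pos ⟨rfl, rfl, rfl⟩, weight]
    split_ifs
    exacts [hb, by norm_num]

theorem matrix_pos (h0 : ∀ b, 0 ≤ enter b) (h1 : ∑ b, enter b = 1) {b : ι × Bool} {j : ℕ}
    (hj : j < L.len b.1) (hb : 0 < enter b) :
    0 < L.matrix enter (L.armCol b j) (L.armCol b (j + 1)) := by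
  rw [← colorMatrix_walk (h0 := h0) (h1 := h1)]
  refine lt_of_le_of_ne (ColoredWalk.colorMatrix_nonneg _ _ _) fun h => ?_
  exact (walk_pos (h0 := h0) (h1 := h1) hj hb).ne'
    (ColoredWalk.p_eq_zero_of_colorMatrix_eq_zero _ h.symm _)

theorem isNearestNeighbor_walk {S : Set G} (hS : ∀ g ∈ S, g⁻¹ ∈ S)
    (hpos : ∀ i, ∀ j < L.len i, (L.pos i j)⁻¹ * L.pos i (j + 1) ∈ S) :
    (L.walk enter h0 h1).IsNearestNeighbor S := by
  intro h hh
  have : ∃ u v, (L.walk enter h0 h1).p h u v ≠ 0 := by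
    by_contra! hz
    exact hh (by ext u v; exact hz u v)
  obtain ⟨u, v, huv⟩ := this
  obtain ⟨⟨i, ε⟩, j, hj, rfl, -⟩ := exists_edge_of_walk_ne_zero huv
  have htrue : ∀ j < L.len i, L.armStep (i, true) j ∈ S := fun j hj => by
    simpa [armStep, armPos] using hpos i j hj
  cases ε with
  | true => exact htrue j hj
  | false =>
    have h := armStep_flip (L := L) (i, false) hj
    rw [← inv_inv (L.armStep (i, false) j), ← h]
    have hj' : j < L.len i := hj
    exact hS _ (htrue (L.len i - 1 - j) (by omega))

/-- Forward arms suffice: their steps multiply to generators of `G`, and going around a loop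
connects each of its colors to `0` both ways. Backward arms may therefore have entrance probability
zero. -/
theorem isQuasiIrreducible_walk [Nonempty ι] (henter : ∀ i, 0 < enter (i, true))
    (hgen : Subgroup.closure (Set.range fun i => L.pos i (L.len i)) = ⊤) :
    (L.walk enter h0 h1).IsQuasiIrreducible := by
  constructor
  · rw [eq_top_iff, ← hgen, Subgroup.closure_le]
    rintro _ ⟨i, rfl⟩
    have : ∀ j ≤ L.len i, L.pos i j ∈ Subgroup.closure (L.walk enter h0 h1).support := by
      intro j hj
      induction j with
      | zero => rw [L.pos_zero]; exact one_mem _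
      | succ j ih =>
        have h2 : L.armStep (i, true) j ∈ (L.walk enter h0 h1).support := fun h => by
          have h3 := walk_pos (h0 := h0) (h1 := h1) (b := (i, true)) (j := j) hj (henter i)
          rw [h] at h3
          exact lt_irrefl _ h3
        have h4 := mul_mem (ih (by omega)) (Subgroup.subset_closure h2)
        simpa [armStep, armPos] using h4
    exact this _ le_rfl
  · rw [colorMatrix_walk]
    refine Matrix.isIrreducible_of_transGen (matrix_nonneg h0) ?_
    have hchain : ∀ i j n, j + n + 1 ≤ L.len i → Relation.TransGen
        (fun a b => 0 < L.matrix enter a b) (L.col i j) (L.col i (j + n + 1)) := by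
      intro i j n hn
      have hstep : ∀ k < L.len i, 0 < L.matrix enter (L.col i k) (L.col i (k + 1)) :=
        fun k hk => by
          simpa [armCol] using matrix_pos (L := L) h0 h1 (b := (i, true)) hk (henter i)
      induction n with
      | zero => exact Relation.TransGen.single (hstep j (by omega))
      | succ n ih => exact (ih (by omega)).tail (hstep _ (by omega))
    have hzero : ∀ c, Relation.TransGen (fun a b => 0 < L.matrix enter a b) 0 c ∧
        Relation.TransGen (fun a b => 0 < L.matrix enter a b) c 0 := by
      intro c
      rcases L.col_surj c with rfl | ⟨i, j, hj, hj', rfl⟩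
      · obtain ⟨i⟩ := ‹Nonempty ι›
        have hl := len_pos (L := L) i
        have := hchain i 0 (L.len i - 1) (by omega)
        rw [show 0 + (L.len i - 1) + 1 = L.len i by omega, L.col_zero, L.col_len] at this
        exact ⟨this, this⟩
      · have h2 := hchain i 0 (j - 1) (by omega)
        have h3 := hchain i j (L.len i - j - 1) (by omega)
        rw [show 0 + (j - 1) + 1 = j by omega, L.col_zero] at h2
        rw [show j + (L.len i - j - 1) + 1 = L.len i by omega, L.col_len] at h3
        exact ⟨h2, h3⟩
    exact fun i j => (hzero i).2.trans (hzero j).1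

end Walk

end LoopSystem

/-! ### Detailed balance -/

namespace LoopSystem

section Reversible

variable {G : Type*} [Group G] {ι : Type*} {r : ℕ} [NeZero r] {L : LoopSystem G ι r}
  {enter : ι × Bool → ℝ}

open Classical in
variable (L) in
/-- The reversible measure of the colors, not normalized. -/
noncomputable def colorMass (enter : ι × Bool → ℝ) (c : Fin r) : ℝ :=
  -- The factor `2` compensates the probability `1 / 2` of each interior step. The forward arm is an
  -- arbitrary choice, harmless when `enter` is invariant under `flip`.
  if h : c = 0 then 1 else 2 * enter (((L.col_surj c).resolve_left h).choose, true)

theorem colorMass_zero : L.colorMass enter 0 = 1 := dif_pos rfl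

theorem colorMass_armCol (hflip : ∀ b, enter (flip b) = enter b) (b : ι × Bool) {j : ℕ}
    (hj : 0 < j) (hj' : j < L.len b.1) : L.colorMass enter (L.armCol b j) = 2 * enter b := by
  have hne : L.armCol b j ≠ 0 := by
    rw [Ne, armCol_eq_zero_iff b hj'.le]; omega
  have hs := ((L.col_surj (L.armCol b j)).resolve_left hne).choose_spec
  rw [colorMass, dif_neg hne]
  set i := ((L.col_surj (L.armCol b j)).resolve_left hne).choose
  obtain ⟨k, hk, hk', hk''⟩ := hs
  have hi : L.armCol b j = L.armCol (i, true) k := by simp [armCol, hk'']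
  rcases eq_or_eq_flip_of_armCol_eq hj hj' (b' := (i, true)) hk'.le hi with h | h
  · rw [h.1]
  · rw [h.1, hflip]

theorem colorMass_nonneg (h0 : ∀ b, 0 ≤ enter b) (c : Fin r) : 0 ≤ L.colorMass enter c := by
  unfold colorMass
  split_ifs
  exacts [zero_le_one, mul_nonneg zero_le_two (h0 _)]

variable [Fintype ι] {h0 : ∀ b, 0 ≤ enter b} {h1 : ∑ b, enter b = 1}

/-- The stationary flow is constant along an arm, which is what makes detailed balance visible. -/
theorem colorMass_mul_weight (hflip : ∀ b, enter (flip b) = enter b) {e : Σ _ : ι × Bool, ℕ}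
    (he : e ∈ L.edges) : L.colorMass enter (L.armCol e.1 e.2) * weight enter e = enter e.1 := by
  unfold weight
  split_ifs with h
  · rw [h, armCol_zero, colorMass_zero, one_mul]
  · rw [colorMass_armCol hflip _ (Nat.pos_of_ne_zero h) (mem_edges.1 he)]; ring

/-- Reversing oriented edges is an involution that swaps endpoints, inverts the group label and
preserves the flow `enter`; it matches the two sums term by term. -/
theorem colorMass_mul_walkMatrix (hflip : ∀ b, enter (flip b) = enter b) (h : G) (u v : Fin r) :
    L.colorMass enter u * L.walkMatrix enter h u v =
      L.colorMass enter v * L.walkMatrix enter h⁻¹ v u := by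
  classical
  have key : ∀ (h : G) (u v : Fin r), L.colorMass enter u * L.walkMatrix enter h u v =
      ∑ e ∈ L.edges, if h = L.armStep e.1 e.2 ∧ L.armCol e.1 e.2 = u ∧
        L.armCol e.1 (e.2 + 1) = v then enter e.1 else 0 := by
    intro h u v
    rw [walkMatrix_apply, Finset.mul_sum]
    refine Finset.sum_congr rfl fun e he => ?_
    split_ifs with hc
    · rw [← hc.2.1, colorMass_mul_weight hflip he]
    · rw [mul_zero]
  rw [key, key]
  have hinv : ∀ e ∈ L.edges, (⟨flip e.1, L.len e.1.1 - 1 - e.2⟩ : Σ _ : ι × Bool, ℕ) ∈ L.edges := by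
    intro e he
    have := mem_edges.1 he
    exact mem_edges.2 (by simp only [flip_fst]; omega)
  have hinv' : ∀ e ∈ L.edges, (⟨flip (flip e.1), L.len (flip e.1).1 - 1 -
      (L.len e.1.1 - 1 - e.2)⟩ : Σ _ : ι × Bool, ℕ) = e := by
    rintro ⟨b, j⟩ he
    have : j < L.len b.1 := mem_edges.1 he
    simp only [flip_flip, flip_fst, Sigma.mk.injEq, heq_eq_eq, true_and]
    omega
  refine Finset.sum_nbij' (fun e => ⟨flip e.1, L.len e.1.1 - 1 - e.2⟩)
    (fun e => ⟨flip e.1, L.len e.1.1 - 1 - e.2⟩) hinv hinv hinv' hinv' ?_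
  rintro ⟨b, j⟩ he
  have hj : j < L.len b.1 := mem_edges.1 he
  have e1 : L.armCol (flip b) (L.len b.1 - 1 - j) = L.armCol b (j + 1) := by
    rw [armCol_flip _ (by omega)]; congr 1; omega
  have e2 : L.armCol (flip b) (L.len b.1 - 1 - j + 1) = L.armCol b j := by
    rw [armCol_flip _ (by omega)]; congr 1; omega
  simp only [hflip, armStep_flip b hj, e1, e2, inv_inj]
  refine if_congr ?_ rfl rfl
  tauto

theorem isReversible_walk (hflip : ∀ b, enter (flip b) = enter b) :
    (L.walk enter h0 h1).IsReversible := by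
  set ρ := L.colorMass enter with hρ
  have hpos : 0 < ∑ c, ρ c := by
    refine Finset.sum_pos' (fun c _ => colorMass_nonneg h0 c) ⟨0, Finset.mem_univ _, ?_⟩
    rw [hρ, colorMass_zero]; exact one_pos
  have hbal : ∀ u v, ρ u * L.matrix enter u v = ρ v * L.matrix enter v u := by
    intro u v
    have hs : ∀ u v, HasSum (fun g => L.walkMatrix enter g u v) (L.matrix enter u v) := fun u v =>
      Pi.hasSum.1 (Pi.hasSum.1 (hasSum_walkMatrix enter) u) v
    have h2 := (hs u v).mul_left (ρ u)
    -- Inversion on `G` aligns the two series, so summing the balance of the walk over `g` gives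
    -- that of the color matrix.
    have h3 := ((Equiv.inv G).hasSum_iff.2 (hs v u)).mul_left (ρ v)
    refine h2.unique ?_
    convert h3 using 2 with g
    exact colorMass_mul_walkMatrix hflip g u v
  refine ⟨fun c => ρ c / ∑ c, ρ c, ⟨fun c => div_nonneg (colorMass_nonneg h0 c) hpos.le, ?_⟩,
    ?_, ?_⟩
  · rw [← Finset.sum_div, div_self hpos.ne']
  · rw [colorMatrix_walk]
    ext v
    simp only [Matrix.vecMul, dotProduct]
    have : ∀ u, ρ u / (∑ c, ρ c) * L.matrix enter u v = ρ v / (∑ c, ρ c) * L.matrix enter v u :=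
      fun u => by rw [div_mul_eq_mul_div, hbal, div_mul_eq_mul_div]
    simp only [this]
    rw [← Finset.mul_sum, sum_matrix h1, mul_one]
  · intro x y
    have h2 := colorMass_mul_walkMatrix (L := L) hflip (x.1⁻¹ * y.1) x.2 y.2
    rw [mul_inv_rev, inv_inv] at h2
    change ρ x.2 / _ * L.walkMatrix enter _ _ _ = ρ y.2 / _ * L.walkMatrix enter _ _ _
    rw [div_mul_eq_mul_div, h2, div_mul_eq_mul_div]

end Reversible

/-! ### The automaton of positions on the arms -/

section Tracker

variable {G : Type*} [Group G] {ι : Type*} {r : ℕ} [NeZero r] {L : LoopSystem G ι r}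

open Classical in
variable (L) in
/-- The position on the arms after a transition to the color `v`. -/
noncomputable def nextState (z : (ι × Bool) × ℕ) (v : Fin r) : (ι × Bool) × ℕ :=
  -- At index `0` the stored arm is forgotten and the new one is read from `v`. The fallback `z` is
  -- never used along transitions of positive probability.
  if z.2 = 0 then (if h : ∃ b, L.armCol b 1 = v then (h.choose, 1) else z)
  else if v = L.armCol z.1 (z.2 + 1) then (z.1, z.2 + 1) else (z.1, z.2 - 1)

theorem nextState_zero (b b' : ι × Bool) : L.nextState (b, 0) (L.armCol b' 1) = (b', 1) := by
  have h : ∃ b, L.armCol b 1 = L.armCol b' 1 := ⟨b', rfl⟩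
  rw [nextState, if_pos rfl, dif_pos h, armCol_one_inj h.choose_spec]

theorem nextState_forward (b : ι × Bool) {j : ℕ} (hj : 0 < j) :
    L.nextState (b, j) (L.armCol b (j + 1)) = (b, j + 1) := by
  rw [nextState, if_neg hj.ne', if_pos rfl]

theorem nextState_backward (b : ι × Bool) {j : ℕ} (hj : 0 < j) (hj' : j < L.len b.1) :
    L.nextState (b, j) (L.armCol b (j - 1)) = (b, j - 1) := by
  rw [nextState, if_neg hj.ne', if_neg (armCol_sub_one_ne b hj hj')]

variable [Fintype ι] {enter : ι × Bool → ℝ} {h0 : ∀ b, 0 ≤ enter b} {h1 : ∑ b, enter b = 1}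

/-- The three possible moves of the walk, seen on the arms. -/
theorem nextState_cases {b : ι × Bool} {j : ℕ} (hj : j < L.len b.1) {h : G} {v : Fin r}
    (hne : (L.walk enter h0 h1).p h (L.armCol b j) v ≠ 0) :
    ∃ b' j', L.nextState (b, j) v = (b', j') ∧ j' ≤ L.len b'.1 ∧ L.armCol b' j' = v ∧
      L.armPos b' j' = L.armPos b j * h := by
  obtain ⟨b', j', hj', rfl, hu, rfl⟩ := exists_edge_of_walk_ne_zero hne
  rcases Nat.eq_zero_or_pos j with rfl | hjpos
  · rw [armCol_zero, armCol_eq_zero_iff _ hj'.le] at hu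
    obtain rfl : j' = 0 := by omega
    exact ⟨b', 1, nextState_zero b b', by omega, rfl, by simp [armStep]⟩
  · rcases eq_or_eq_flip_of_armCol_eq hjpos hj hj'.le hu.symm with ⟨rfl, rfl⟩ | ⟨rfl, rfl⟩
    · exact ⟨b', j' + 1, nextState_forward b' hjpos, hj, rfl, by simp [armStep]⟩
    · have e : L.armCol (flip b) (L.len b.1 - j + 1) = L.armCol b (j - 1) := by
        rw [armCol_flip _ (by omega)]; congr 1; omega
      refine ⟨b, j - 1, by rw [e, nextState_backward b hjpos hj], by omega, e.symm, ?_⟩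
      have h2 := armStep_flip (L := L) b (j := j - 1) (by omega)
      rw [show L.len b.1 - 1 - (j - 1) = L.len b.1 - j by omega] at h2
      rw [h2, armStep, Nat.sub_add_cancel hjpos]
      group

variable (L h0 h1) in
/-- The automaton that records the position on the arms; a renewal happens at the end of an arm. -/
noncomputable def tracker (b₀ : ι × Bool) :
    RenewalTracker (L.walk enter h0 h1) ((ι × Bool) × ℕ) where
  root := (b₀, 0)
  live := {z | z.2 < L.len z.1.1}
  terminal := {z | z.2 = L.len z.1.1}
  next := L.nextState
  color z := L.armCol z.1 z.2
  disp z := L.armPos z.1 z.2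
  root_mem := len_pos b₀.1
  color_root := armCol_zero b₀
  disp_root := armPos_zero b₀
  notMem_terminal _ h := ne_of_lt h
  color_terminal := by
    rintro ⟨b, j⟩ (rfl : j = L.len b.1)
    exact armCol_len b
  next_mem := by
    rintro ⟨b, j⟩ hz h v hne
    obtain ⟨b', j', e, hle, -⟩ := nextState_cases hz hne
    rw [e]
    exact lt_or_eq_of_le hle
  color_next := by
    rintro ⟨b, j⟩ hz h v hne
    obtain ⟨b', j', e, -, hc, -⟩ := nextState_cases hz hne
    rw [e]
    exact hc
  disp_next := by
    rintro ⟨b, j⟩ hz h v hne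
    obtain ⟨b', j', e, -, -, hd⟩ := nextState_cases hz hne
    rw [e]
    exact hd

theorem sum_colorMatrix_root_mul (φ : (ι × Bool) × ℕ → ℝ) (b : ι × Bool) :
    ∑ v, (L.walk enter h0 h1).colorMatrix (L.armCol b 0) v * φ (L.nextState (b, 0) v) =
      ∑ b', enter b' * φ (b', 1) := by
  rw [colorMatrix_walk, armCol_zero, sum_matrix_zero_mul enter fun v => φ (L.nextState (b, 0) v)]
  simp only [nextState_zero]

theorem sum_colorMatrix_arm_mul (φ : (ι × Bool) × ℕ → ℝ) (b : ι × Bool) {j : ℕ}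
    (hj : 0 < j) (hj' : j < L.len b.1) :
    ∑ v, (L.walk enter h0 h1).colorMatrix (L.armCol b j) v * φ (L.nextState (b, j) v) =
      1 / 2 * φ (b, j + 1) + 1 / 2 * φ (b, j - 1) := by
  rw [colorMatrix_walk,
    sum_matrix_armCol_mul enter (fun v => φ (L.nextState (b, j) v)) b hj hj',
    nextState_forward b hj, nextState_backward b hj hj']

end Tracker

/-- If the arm `b` is entered with probability proportional to `e b * len b`, then the successive
complete traversals of the loops are independent, and the arm `b` is traversed with probability
`e b`. -/
theorem linearizes_walk {G : Type u} [Group G] [MeasurableSpace G] [DiscreteMeasurableSpace G]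
    [Countable G] {ι : Type*} [Fintype ι] {r : ℕ} [NeZero r] {L : LoopSystem G ι r}
    {enter : ι × Bool → ℝ} {h0 : ∀ b, 0 ≤ enter b} {h1 : ∑ b, enter b = 1}
    {e : ι × Bool → ℝ} {C : ℝ} (he1 : ∑ b, e b = 1)
    (hC : ∀ b, enter b = e b * L.len b.1 / C) {p : G → ℝ} (hp0 : ∀ g, 0 ≤ p g)
    (hp1 : ∀ g, p g ≤ 1) [DecidableEq G]
    (hp : ∀ g, ∑ b, e b * (if L.armPos b (L.len b.1) = g then 1 else 0) = p g) :
    (L.walk enter h0 h1).Linearizes p := by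
  have hne : (Finset.univ : Finset (ι × Bool)).Nonempty := by
    by_contra h
    rw [Finset.not_nonempty_iff_eq_empty] at h
    rw [h, Finset.sum_empty] at he1
    exact zero_ne_one he1
  obtain ⟨b₀, -⟩ := hne
  have hlen : ∀ i, (0 : ℝ) < L.len i := fun i => Nat.cast_pos.2 (len_pos i)
  let R := L.tracker h0 h1 b₀
  set K : ℝ := ∑ i, (L.len i : ℝ) with hK
  have hlenK : ∀ i, (L.len i : ℝ) ≤ K := fun i =>
    Finset.single_le_sum (f := fun i => (L.len i : ℝ)) (fun i _ => (hlen i).le) (Finset.mem_univ i)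
  have hind : ∀ (b : ι × Bool) (g : G),
      0 ≤ (if L.armPos b (L.len b.1) = g then (1 : ℝ) else 0) ∧
      (if L.armPos b (L.len b.1) = g then (1 : ℝ) else 0) ≤ 1 := fun b g => by
    split_ifs <;> norm_num
  have hratio : ∀ z ∈ R.live, 0 ≤ (z.2 : ℝ) / L.len z.1.1 ∧ (z.2 : ℝ) / L.len z.1.1 ≤ 1 := by
    intro z hz
    have hz' : (z.2 : ℝ) ≤ L.len z.1.1 := Nat.cast_le.2 (le_of_lt (show z.2 < L.len z.1.1 from hz))
    exact ⟨div_nonneg (Nat.cast_nonneg _) (hlen _).le, (div_le_one (hlen _)).2 hz'⟩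
  -- Both `(j + 1)² + (j - 1)² = 2 j² + 2` inside an arm and the forced move from `0` to `1` give
  -- drift exactly `-1`. The constant `K` only has to dominate every length.
  let f : (ι × Bool) × ℕ → ℝ := fun z => K ^ 2 - (z.2 : ℝ) ^ 2
  -- Gambler's ruin: from index `j` the arm is completed first with probability `j / len`; otherwise
  -- the walk restarts at `0`, where the answer is `p g`.
  let H : G → (ι × Bool) × ℕ → ℝ := fun g z => (1 - (z.2 : ℝ) / L.len z.1.1) * p g +
    (z.2 : ℝ) / L.len z.1.1 * if L.armPos z.1 (L.len z.1.1) = g then 1 else 0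
  refine R.linearizes (f := f) (H := H) ?_ ?_ ?_ ?_ ?_ ?_ ?_ ?_
  · intro z hz
    have hz' : z.2 ≤ L.len z.1.1 := hz.elim (fun h => le_of_lt h) fun h => le_of_eq h
    have : (z.2 : ℝ) ≤ K := (Nat.cast_le.2 hz').trans (hlenK _)
    exact sub_nonneg.2 (pow_le_pow_left₀ (Nat.cast_nonneg z.2) this 2)
  · rintro ⟨b, j⟩ (hz : j < L.len b.1)
    rcases Nat.eq_zero_or_pos j with rfl | hj
    · refine (sum_colorMatrix_root_mul (L := L) (h0 := h0) (h1 := h1) f b).trans_le ?_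
      simp [f, ← Finset.sum_mul, h1]
    · refine ((sum_colorMatrix_arm_mul (L := L) (h0 := h0) (h1 := h1) f b hj hz).trans ?_).le
      simp only [f, Nat.cast_add, Nat.cast_one, Nat.cast_sub (show 1 ≤ j from hj)]
      ring
  · intro g z hz
    have h2 := hratio z hz
    exact add_nonneg (mul_nonneg (by linarith) (hp0 g)) (mul_nonneg h2.1 (hind z.1 g).1)
  · intro g z hz
    have h2 := hratio z hz
    have h3 := mul_le_mul_of_nonneg_left (hp1 g) (show 0 ≤ 1 - (z.2 : ℝ) / L.len z.1.1 by linarith)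
    have h4 := mul_le_mul_of_nonneg_left (hind z.1 g).2 h2.1
    simp only [H]
    linarith
  · rintro g ⟨b, j⟩ (rfl : j = L.len b.1) (hd : L.armPos b (L.len b.1) = g)
    simp [H, hd, div_self (hlen b.1).ne']
  · rintro g ⟨b, j⟩ (rfl : j = L.len b.1) (hd : L.armPos b (L.len b.1) ≠ g)
    simp [H, hd, div_self (hlen b.1).ne']
  · rintro g ⟨b, j⟩ (hz : j < L.len b.1)
    rcases Nat.eq_zero_or_pos j with rfl | hj
    · refine (sum_colorMatrix_root_mul (L := L) (h0 := h0) (h1 := h1) (H g) b).trans ?_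
      -- The factor `len` in `enter` cancels the success probability `1 / len`. What remains is `1 /
      -- C` times a difference whose sum over the arms is `p g - p g`.
      have hterm : ∀ b : ι × Bool, enter b * ((1 - ((1 : ℕ) : ℝ) / L.len b.1) * p g +
          ((1 : ℕ) : ℝ) / L.len b.1 * if L.armPos b (L.len b.1) = g then 1 else 0) =
          enter b * p g + 1 / C * (e b * (if L.armPos b (L.len b.1) = g then 1 else 0) -
            e b * p g) := by
        intro b
        have h5 : enter b * (1 / L.len b.1) = 1 / C * e b := by
          rw [hC]
          have := (hlen b.1).ne'
          field_simp
        rw [Nat.cast_one]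
        linear_combination (-p g + if L.armPos b (L.len b.1) = g then 1 else 0) * h5
      rw [Finset.sum_congr rfl fun b _ => hterm b, Finset.sum_add_distrib, ← Finset.mul_sum,
        Finset.sum_sub_distrib, hp, ← Finset.sum_mul, ← Finset.sum_mul, h1, he1]
      simp [H]
    · refine (sum_colorMatrix_arm_mul (L := L) (h0 := h0) (h1 := h1) (H g) b hj hz).trans ?_
      simp only [H, Nat.cast_add, Nat.cast_one, Nat.cast_sub (show 1 ≤ j from hj)]
      ring
  · intro g
    change (1 - ((0 : ℕ) : ℝ) / L.len b₀.1) * p g + ((0 : ℕ) : ℝ) / L.len b₀.1 * _ = p g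
    simp

/-- Loops of prescribed lengths and paths. -/
theorem exists_loopSystem {G : Type*} [Group G] {ι : Type*} [Fintype ι] (len : ι → ℕ)
    (hlen : ∀ i, 3 ≤ len i) (pos : ι → ℕ → G) (hpos : ∀ i, pos i 0 = 1) :
    ∃ (r : ℕ) (_ : NeZero r) (L : LoopSystem G ι r), L.len = len ∧ L.pos = pos := by
  classical
  let X := Σ i, Fin (len i - 1)
  let E : Option X ≃ Fin (Fintype.card X + 1) :=
    -- The colors are the interior points of the loops plus the common base point `none`, which is
    -- numbered `0`.
    (Equiv.optionCongr (Fintype.equivFin X)).trans (finSuccEquiv _).symm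
  have hE : E none = 0 := by simp [E]
  let o : ι → ℕ → Option X := fun i j =>
    if h : 0 < j ∧ j < len i then some ⟨i, ⟨j - 1, by omega⟩⟩ else none
  have ho : ∀ i j, (h : 0 < j ∧ j < len i) → o i j = some ⟨i, ⟨j - 1, by omega⟩⟩ :=
    fun i j h => dif_pos h
  have ho' : ∀ i j, ¬ (0 < j ∧ j < len i) → o i j = none := fun i j h => dif_neg h
  refine ⟨Fintype.card X + 1, inferInstance, ⟨len, hlen, fun i j => E (o i j), fun i => ?_,
    fun i => ?_, fun {i j i' j'} hj hj' hj'' h => ?_, fun c => ?_, pos, hpos⟩, rfl, rfl⟩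
  · rw [ho' _ _ (by omega), hE]
  · rw [ho' _ _ (by omega), hE]
  · have h2 := E.injective h
    rw [ho i j ⟨hj, hj'⟩] at h2
    by_cases h3 : 0 < j' ∧ j' < len i'
    · rw [ho i' j' h3, Option.some_inj, Sigma.mk.injEq] at h2
      obtain ⟨rfl, h4⟩ := h2
      have h5 := congrArg Fin.val (eq_of_heq h4)
      simp only at h5
      exact ⟨rfl, by omega⟩
    · rw [ho' _ _ h3] at h2
      exact absurd h2 (by simp)
  · obtain ⟨x, rfl⟩ := E.surjective c
    rcases x with _ | ⟨i, k⟩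
    · exact Or.inl hE
    · have hk := k.2
      refine Or.inr ⟨i, k + 1, by omega, by omega, ?_⟩
      rw [ho _ _ ⟨by omega, by omega⟩]
      simp

end LoopSystem

/-! ### Words in the generators -/

section Words

variable {G : Type*} [Group G] {S : Set G}

/-- Symmetry of `S` absorbs the inverses, so the generated subgroup consists of products of letters
of `S`. -/
theorem exists_list_prod_eq (hS_symm : ∀ g ∈ S, g⁻¹ ∈ S) (hS_gen : Subgroup.closure S = ⊤) (g : G) :
    ∃ l : List S, (l.map Subtype.val).prod = g := by
  have hg : g ∈ Subgroup.closure S := hS_gen ▸ Subgroup.mem_top g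
  induction hg using Subgroup.closure_induction_right with
  | one => exact ⟨[], rfl⟩
  | mul_right x _ y hy ih =>
    obtain ⟨l, rfl⟩ := ih
    exact ⟨l ++ [⟨y, hy⟩], by simp⟩
  | mul_inv_cancel x _ y hy ih =>
    obtain ⟨l, rfl⟩ := ih
    exact ⟨l ++ [⟨y⁻¹, hS_symm y hy⟩], by simp⟩

theorem countable_of_closure_eq_top (hS : S.Countable) (hS_symm : ∀ g ∈ S, g⁻¹ ∈ S)
    (hS_gen : Subgroup.closure S = ⊤) : Countable G := by
  have := hS.to_subtype
  exact Function.Surjective.countable (exists_list_prod_eq hS_symm hS_gen)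

/-- Every element is the end of a path of length at least `3` from the identity. -/
theorem exists_path (hS_nonempty : S.Nonempty) (hS_symm : ∀ g ∈ S, g⁻¹ ∈ S)
    (hS_gen : Subgroup.closure S = ⊤) (g : G) :
    ∃ (n : ℕ) (x : ℕ → G), 3 ≤ n ∧ x 0 = 1 ∧ x n = g ∧ ∀ j < n, (x j)⁻¹ * x (j + 1) ∈ S := by
  obtain ⟨s, hs⟩ := hS_nonempty
  -- Appending `s⁻¹` three times to a word for `g * s * s * s` forces length at least `3` and brings
  -- the endpoint back to `g`.
  obtain ⟨l, hl⟩ := exists_list_prod_eq hS_symm hS_gen (g * s * s * s)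
  let t : S := ⟨s⁻¹, hS_symm s hs⟩
  let m : List G := (l ++ [t, t, t]).map Subtype.val
  refine ⟨m.length, fun j => (m.take j).prod, by simp [m], by simp, ?_, fun j hj => ?_⟩
  · simp only [List.take_length, m, List.map_append, List.prod_append, hl]
    simp [t, mul_assoc]
  · simp only [List.prod_take_succ m j hj, inv_mul_cancel_left]
    have h : m[j] ∈ m := List.getElem_mem hj
    obtain ⟨y, -, hy⟩ := List.mem_map.1 h
    exact hy ▸ y.2

end Words

/-- A random walk whose step is `x i` with probability `e (i, true)` and `(x i)⁻¹` with probability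
`e (i, false)` is linearized by a walk around loops, which is reversible if `e` is symmetric. -/
theorem exists_linearizing_walk {G : Type u} [Group G] [MeasurableSpace G]
    [DiscreteMeasurableSpace G] [DecidableEq G] {S : Set G} (hS : S.Countable)
    (hS_nonempty : S.Nonempty) (hS_symm : ∀ g ∈ S, g⁻¹ ∈ S) (hS_gen : Subgroup.closure S = ⊤)
    {ι : Type*} [Fintype ι] [Nonempty ι] {x : ι → G}
    (hx : Subgroup.closure (Set.range x) = ⊤) {e : ι × Bool → ℝ} (he0 : ∀ b, 0 ≤ e b)
    (he : ∀ i, 0 < e (i, true)) (he1 : ∑ b, e b = 1) {p : G → ℝ}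
    (hp : ∀ g, ∑ i, (e (i, true) * (if x i = g then 1 else 0) +
      e (i, false) * (if (x i)⁻¹ = g then 1 else 0)) = p g) :
    ∃ (r : ℕ) (_ : NeZero r) (W : ColoredWalk G r),
      W.IsNearestNeighbor S ∧ W.IsQuasiIrreducible ∧ W.Linearizes p ∧
      ((∀ i, e (i, false) = e (i, true)) → W.IsReversible) := by
  have := countable_of_closure_eq_top hS hS_symm hS_gen
  choose len pos h3 hzero hend hstep using
    fun i => exists_path hS_nonempty hS_symm hS_gen (x i)
  obtain ⟨r, hr, L, rfl, rfl⟩ := LoopSystem.exists_loopSystem len h3 pos hzero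
  have hlen : ∀ i, (0 : ℝ) < L.len i := fun i => Nat.cast_pos.2 (LoopSystem.len_pos i)
  -- `C` normalizes the length-biased law of the entered arm.
  set C : ℝ := ∑ b, e b * L.len b.1 with hC
  have hCpos : 0 < C := by
    obtain ⟨i⟩ := ‹Nonempty ι›
    exact Finset.sum_pos' (fun b _ => mul_nonneg (he0 b) (hlen _).le)
      ⟨(i, true), Finset.mem_univ _, mul_pos (he i) (hlen i)⟩
  set enter : ι × Bool → ℝ := fun b => e b * L.len b.1 / C with henter
  have h0 : ∀ b, 0 ≤ enter b := fun b => div_nonneg (mul_nonneg (he0 b) (hlen _).le) hCpos.le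
  have h1 : ∑ b, enter b = 1 := by rw [henter, ← Finset.sum_div, ← hC, div_self hCpos.ne']
  have harm : ∀ g, ∑ b, e b * (if L.armPos b (L.len b.1) = g then 1 else 0) = p g := by
    intro g
    rw [← hp g, Fintype.sum_prod_type]
    refine Finset.sum_congr rfl fun i _ => ?_
    simp [LoopSystem.armPos, hend, hzero]
  have hp0 : ∀ g, 0 ≤ p g := fun g => by
    rw [← harm g]
    exact Finset.sum_nonneg fun b _ => mul_nonneg (he0 b) (by split_ifs <;> norm_num)
  have hp1 : ∀ g, p g ≤ 1 := fun g => by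
    rw [← harm g]
    exact (Finset.sum_le_sum fun b _ => mul_le_of_le_one_right (he0 b)
      (by split_ifs <;> norm_num)).trans he1.le
  refine ⟨r, hr, L.walk enter h0 h1, LoopSystem.isNearestNeighbor_walk hS_symm hstep,
    LoopSystem.isQuasiIrreducible_walk
      (fun i => div_pos (mul_pos (he i) (hlen i)) hCpos) ?_,
    LoopSystem.linearizes_walk he1 (fun b => rfl) hp0 hp1 harm,
    fun hflip => LoopSystem.isReversible_walk ?_⟩
  · simpa only [hend] using hx
  · rintro ⟨i, _ | _⟩ <;> simp [henter, LoopSystem.flip, hflip]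

theorem theorem1 {G : Type u} [Group G] [MeasurableSpace G] [DiscreteMeasurableSpace G]
    (S : Finset G) (hS_nonempty : S.Nonempty) (hS_symm : ∀ g ∈ S, g⁻¹ ∈ S)
    (hS_gen : Subgroup.closure (S : Set G) = ⊤)
    (p : G → ℝ) (hp_nonneg : ∀ g, 0 ≤ p g) (hp_sum : HasSum p 1)
    (hp_fin : (Function.support p).Finite)
    (hp_gen : Subgroup.closure (Function.support p) = ⊤) :
    (∃ (r : ℕ) (_ : NeZero r) (W : ColoredWalk G r),
      W.IsNearestNeighbor S ∧ W.IsQuasiIrreducible ∧ W.Linearizes p) ∧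
    (IsReversibleWrt (walkKernel p) (fun _ => 1) →
      ∃ (r : ℕ) (_ : NeZero r) (W : ColoredWalk G r),
        W.IsNearestNeighbor S ∧ W.IsQuasiIrreducible ∧ W.Linearizes p ∧ W.IsReversible) := by
  classical
  let ι := Function.support p
  have : Fintype ι := hp_fin.fintype
  have hsum : ∑ i : ι, p i = 1 := by
    have h := (hasSum_subtype_support (f := p) (a := 1)).2 hp_sum
    exact (hasSum_fintype _).unique h
  have : Nonempty ι := by
    by_contra h
    rw [not_nonempty_iff] at h
    simp at hsum
  have hpos : ∀ i : ι, 0 < p i := fun i => lt_of_le_of_ne (hp_nonneg i) (Ne.symm i.2)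
  have hdelta : ∀ g, ∑ i : ι, p i * (if (i : G) = g then 1 else 0) = p g := by
    intro g
    by_cases hg : p g = 0
    · rw [hg]
      refine Finset.sum_eq_zero fun i _ => ?_
      rw [if_neg, mul_zero]
      rintro rfl
      exact i.2 hg
    · rw [Finset.sum_eq_single (⟨g, hg⟩ : ι)]
      · simp
      · intro i _ hi
        rw [if_neg fun h => hi (Subtype.ext h), mul_zero]
      · exact fun h => absurd (Finset.mem_univ _) h
  have hgen : Subgroup.closure (Set.range fun i : ι => (i : G)) = ⊤ := by
    rw [Subtype.range_coe]; exact hp_gen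
  constructor
  · obtain ⟨r, hr, W, h1, h2, h3, -⟩ := exists_linearizing_walk S.countable_toSet
      (Finset.coe_nonempty.2 hS_nonempty) hS_symm hS_gen hgen
      -- All the mass is on the forward arms; backward arms are never entered from `0`.
      (e := fun b => if b.2 then p b.1 else 0)
      (fun b => by split_ifs; exacts [hp_nonneg _, le_rfl])
      (fun i => by simpa using hpos i)
      (by simpa [Fintype.sum_prod_type] using hsum) (p := p)
      (fun g => by simpa using hdelta g)
    exact ⟨r, hr, W, h1, h2, h3⟩
  · intro hrev
    -- Reversibility for the counting measure, tested at the pair `(g, 1)`, is the symmetry of `p`.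
    have hinv : ∀ g, p g⁻¹ = p g := fun g => by
      have h := hrev g 1
      simpa [walkKernel] using h
    obtain ⟨r, hr, W, h1, h2, h3, h4⟩ := exists_linearizing_walk S.countable_toSet
      (Finset.coe_nonempty.2 hS_nonempty) hS_symm hS_gen hgen
      -- Each direction gets half the mass. By symmetry of `p`, the forward and the backward arms
      -- each contribute `p g / 2`.
      (e := fun b => p b.1 / 2) (fun b => div_nonneg (hp_nonneg _) zero_le_two)
      (fun i => half_pos (hpos i))
      (by simpa only [Fintype.sum_prod_type, Fintype.sum_bool, add_halves] using hsum) (p := p)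
      (fun g => by
        have ha := hdelta g
        have hb := hdelta g⁻¹
        rw [hinv] at hb
        simp only [inv_eq_iff_eq_inv, Finset.sum_add_distrib, div_mul_eq_mul_div]
        rw [← Finset.sum_div, ← Finset.sum_div, ha, hb, add_halves])
    exact ⟨r, hr, W, h1, h2, h3, h4 fun i => rfl⟩
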